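/- Let $M$ be a connected smooth manifold of dimension $n$ (Hausdorff, second countable), let $T_0M$ be its tangent bundle $TM$ without the zero section, with induced coordinates $(x^i,y^i)$, let $\mathcal C=y^i\frac{\partial}{\partial y^i}$ be the Liouville vector field and $J=dx^i\otimes\frac{\partial}{\partial y^i}$ the tangent endomorphism. A spray is a smooth vector field $S$ on $T_0M$ with $JS=\mathcal C$ and $[\mathcal C,S]=S$. With Frölicher–Nijenhuis brackets, it induces the projectors $h=\frac12(\mathrm{Id}-[S,J])$ and $v=\frac12(\mathrm{Id}+[S,J])$, the Jacobi endomorphism $\Phi=v\circ[S,h]$ and the curvature $R=\frac12[h,h]$, that is, $R(X,Y)=[hX,hY]+h[X,Y]-h[hX,Y]-h[X,hY]$. The spray $S$ is isotropic, with semi-basic $1$-form $\alpha$, if $\alpha$ is a smooth $1$-form on $T_0M$ vanishing on vertical vectors and $\Phi=\rho J-\alpha\otimes\mathcal C$ for some $\rho\in C^\infty(T_0M)$. A Hamel function for $S$ is a function $P\in C^\infty(T_0M)$ with $\mathcal C(P)=P$ and $\delta_SP:=\mathcal L_Sd_JP-dP=0$. For a vector valued $1$-form $K$ put $d_Kf=df\circ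 K$ on functions and $d_K\alpha=i_Kd\alpha-d\,i_K\alpha$ on $1$-forms, where $(i_Kd\alpha)(X,Y)=d\alpha(KX,Y)+d\alpha(X,KY)$ and $i_K\alpha=\alpha\circ K$; put $(d_RP)(X,Y)=dP(R(X,Y))$ and $(\alpha\wedge\beta)(X,Y)=\alpha(X)\beta(Y)-\alpha(Y)\beta(X)$. Let $S$ and $\overline S=S-2P\mathcal C$ be two projectively related isotropic sprays on $T_0M$, with semi-basic $1$-forms $\alpha$ and $\overline\alpha$ respectively, where $P$ is a Hamel function for $S$, and let $h$, $\overline h$ be the horizontal projectors of $S$, $\overline S$, and $R$ the curvature of $S$. Then, on $T_0M$, $$d_{\overline h}\,\overline\alpha=d_h\alpha-d_RP-P\,d_J\alpha+\alpha\wedge d_JP .$$ -/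

import Mathlib

open scoped Manifold ContDiff

noncomputable section

namespace SprayGeometry

/-! Vector fields, functions and forms on the slit tangent bundle are represented by objects given at
all points of the tangent bundle `TM`, of which only the restriction to the open set of nonzero
tangent vectors matters.  Tensor fields are represented by their action on vector fields. -/

section

variable {n : ℕ} {M : Type*} [TopologicalSpace M] [ChartedSpace (EuclideanSpace ℝ (Fin n)) M]
  [IsManifold (𝓡 n) ∞ M]

/-- The slit tangent bundle `T₀M`: the tangent bundle without its zero section. -/
def slit (n : ℕ) (M : Type*) [TopologicalSpace M] [ChartedSpace (EuclideanSpace ℝ (Fin n)) M]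
    [IsManifold (𝓡 n) ∞ M] : Set (TangentBundle (𝓡 n) M) :=
  {p | p.2 ≠ 0}

/-- A (not necessarily smooth) vector field on `TM`. -/
abbrev VField (n : ℕ) (M : Type*) [TopologicalSpace M]
    [ChartedSpace (EuclideanSpace ℝ (Fin n)) M] [IsManifold (𝓡 n) ∞ M] :=
  (p : TangentBundle (𝓡 n) M) → TangentSpace (𝓡 n).tangent p

/-- A (not necessarily smooth) 1-form on `TM`. -/
abbrev OneForm (n : ℕ) (M : Type*) [TopologicalSpace M]
    [ChartedSpace (EuclideanSpace ℝ (Fin n)) M] [IsManifold (𝓡 n) ∞ M] :=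
  (p : TangentBundle (𝓡 n) M) → TangentSpace (𝓡 n).tangent p →L[ℝ] ℝ

/-- `f ∈ C^∞(T₀M)`. -/
def SmoothFun (f : TangentBundle (𝓡 n) M → ℝ) : Prop :=
  ContMDiffOn (𝓡 n).tangent 𝓘(ℝ, ℝ) ∞ f (slit n M)

/-- `X ∈ 𝔛(T₀M)`: the vector field is smooth on `T₀M`. -/
def SmoothField (X : VField n M) : Prop :=
  ContMDiffOn (𝓡 n).tangent (𝓡 n).tangent.tangent ∞
    (fun p => (⟨p, X p⟩ : TangentBundle (𝓡 n).tangent (TangentBundle (𝓡 n) M))) (slit n M)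

/-- The derivative `X f` of a function along a vector field. -/
def dirDeriv (X : VField n M) (f : TangentBundle (𝓡 n) M → ℝ) : TangentBundle (𝓡 n) M → ℝ :=
  fun p => mvfderiv (𝓡 n).tangent f p (X p)

/-- The Lie bracket `[X, Y]` of vector fields on the manifold `TM`. -/
def lie (X Y : VField n M) : VField n M :=
  VectorField.mlieBracket (𝓡 n).tangent X Y

/-- The differential at `p ∈ TM` of the projection `π : TM → M`. -/
def dproj (p : TangentBundle (𝓡 n) M) (w : TangentSpace (𝓡 n).tangent p) :
    TangentSpace (𝓡 n) p.1 :=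
  mfderiv (𝓡 n).tangent (𝓡 n) (fun q : TangentBundle (𝓡 n) M => q.1) p w

/-- The vertical lift of `u ∈ T_xM` to `p = (x, y) ∈ TM`: the velocity at `t = 0` of the curve
`t ↦ (x, y + t u)`. -/
def vlift (p : TangentBundle (𝓡 n) M) (u : TangentSpace (𝓡 n) p.1) :
    TangentSpace (𝓡 n).tangent p :=
  mfderiv 𝓘(ℝ, ℝ) (𝓡 n).tangent
    (fun t : ℝ => (⟨p.1, p.2 + t • u⟩ : TangentBundle (𝓡 n) M)) (0 : ℝ) (1 : ℝ)

/-- The Liouville vector field `C = yⁱ ∂/∂yⁱ`. -/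
def liouville : VField n M := fun p => vlift p p.2

/-- The tangent endomorphism `J = dxⁱ ⊗ ∂/∂yⁱ`. -/
def tangentEndo (X : VField n M) : VField n M := fun p => vlift p (dproj p (X p))

/-- A spray: a smooth vector field on `T₀M` with `J S = C` and `[C, S] = S`. -/
structure IsSpray (S : VField n M) : Prop where
  smooth : SmoothField S
  semispray : ∀ p ∈ slit n M, tangentEndo S p = liouville p
  homogeneous : ∀ p ∈ slit n M, lie liouville S p = S p

/-- The Frölicher–Nijenhuis bracket `[S, K]` of a vector field and a vector valued 1-form, that is,
the Lie derivative of `K` along `S`. -/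
def fnBracket₀₁ (S : VField n M) (K : VField n M → VField n M) (X : VField n M) : VField n M :=
  lie S (K X) - K (lie S X)

/-- The Frölicher–Nijenhuis bracket `[K, L]` of two vector valued 1-forms, a vector valued
2-form. -/
def fnBracket₁₁ (K L : VField n M → VField n M) (X Y : VField n M) : VField n M :=
  lie (K X) (L Y) + lie (L X) (K Y) + K (L (lie X Y)) + L (K (lie X Y))
    - K (lie (L X) Y + lie X (L Y)) - L (lie (K X) Y + lie X (K Y))

/-- The horizontal projector `h = ½ (Id - [S, J])`. -/
def horiz (S : VField n M) (X : VField n M) : VField n M :=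
  (1 / 2 : ℝ) • (X - fnBracket₀₁ S tangentEndo X)

/-- The vertical projector `v = ½ (Id + [S, J])`. -/
def vert (S : VField n M) (X : VField n M) : VField n M :=
  (1 / 2 : ℝ) • (X + fnBracket₀₁ S tangentEndo X)

/-- The Jacobi endomorphism `Φ = v ∘ [S, h]`. -/
def jacobiEndo (S : VField n M) (X : VField n M) : VField n M :=
  vert S (fnBracket₀₁ S (horiz S) X)

/-- The curvature `R = ½ [h, h]` of the nonlinear connection. -/
def curvature (S : VField n M) (X Y : VField n M) : VField n M :=
  (1 / 2 : ℝ) • fnBracket₁₁ (horiz S) (horiz S) X Y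

/-- The function `α(X)`. -/
def ev (α : OneForm n M) (X : VField n M) : TangentBundle (𝓡 n) M → ℝ := fun p => α p (X p)

/-- `α ∈ Λ¹(T₀M)` is (smooth and) semi-basic: it vanishes on vertical vectors. -/
structure IsSemiBasic (α : OneForm n M) : Prop where
  smooth : ∀ X : VField n M, SmoothField X → SmoothFun (ev α X)
  vertical : ∀ p ∈ slit n M, ∀ w : TangentSpace (𝓡 n).tangent p, dproj p w = 0 → α p w = 0

/-- The spray `S` is isotropic with semi-basic 1-form `α`: one has `Φ = ρ J - α ⊗ C` on `T₀M` for a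
function `ρ ∈ C^∞(T₀M)`.  (Contracting with `S`, and taking the trace, shows that necessarily
`ρ = α(S)` and `(n - 1) ρ = Tr Φ`, so that for `n ≥ 2` both `ρ` and `α` are determined by `S`.) -/
def IsIsotropicWith (S : VField n M) (α : OneForm n M) : Prop :=
  IsSemiBasic α ∧ ∃ ρ : TangentBundle (𝓡 n) M → ℝ, SmoothFun ρ ∧
    ∀ X : VField n M, SmoothField X → ∀ p ∈ slit n M,
      jacobiEndo S X p = ρ p • tangentEndo X p - α p (X p) • liouville p

/-- The Euler–Lagrange 1-form `δ_S L = 𝓛_S d_J L - dL`, evaluated on a vector field. -/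
def eulerLagrange (S : VField n M) (L : TangentBundle (𝓡 n) M → ℝ) (X : VField n M) :
    TangentBundle (𝓡 n) M → ℝ :=
  dirDeriv S (dirDeriv (tangentEndo X) L) - dirDeriv (tangentEndo (lie S X)) L - dirDeriv X L

/-- A Hamel function for `S`: a smooth 1-homogeneous function `P` on `T₀M` with `δ_S P = 0`. -/
structure IsHamel (S : VField n M) (P : TangentBundle (𝓡 n) M → ℝ) : Prop where
  smooth : SmoothFun P
  homogeneous : ∀ p ∈ slit n M, dirDeriv liouville P p = P p
  eulerLagrange_eq_zero : ∀ X : VField n M, SmoothField X → ∀ p ∈ slit n M,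
    eulerLagrange S P X p = 0

/-- The exterior derivative of a 1-form: `dα(X, Y) = X(α(Y)) - Y(α(X)) - α([X, Y])`. -/
def extD (α : OneForm n M) (X Y : VField n M) : TangentBundle (𝓡 n) M → ℝ :=
  dirDeriv X (ev α Y) - dirDeriv Y (ev α X) - ev α (lie X Y)

/-- The derivative `d_K α = i_K dα - d i_K α` of a 1-form along a vector valued 1-form `K`, evaluated
on two vector fields, where `(i_K dα)(X, Y) = dα(KX, Y) + dα(X, KY)` and `i_K α = α ∘ K`. -/
def dAlong (K : VField n M → VField n M) (α : OneForm n M) (X Y : VField n M) :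
    TangentBundle (𝓡 n) M → ℝ :=
  (extD α (K X) Y + extD α X (K Y)) -
    (dirDeriv X (ev α (K Y)) - dirDeriv Y (ev α (K X)) - ev α (K (lie X Y)))

/-- The 2-form `d_R P = i_R dP`, that is, `(d_R P)(X, Y) = R(X, Y) P`, for the curvature `R`. -/
def dCurv (S : VField n M) (P : TangentBundle (𝓡 n) M → ℝ) (X Y : VField n M) :
    TangentBundle (𝓡 n) M → ℝ :=
  dirDeriv (curvature S X Y) P

/-- The 2-form `(α ∧ d_J P)(X, Y) = α(X) d_J P(Y) - α(Y) d_J P(X)`, where `d_J P(X) = (J X) P`. -/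
def wedgeDJ (α : OneForm n M) (P : TangentBundle (𝓡 n) M → ℝ) (X Y : VField n M) :
    TangentBundle (𝓡 n) M → ℝ :=
  ev α X * dirDeriv (tangentEndo Y) P - ev α Y * dirDeriv (tangentEndo X) P

end


end SprayGeometry

end

open SprayGeometry

/-! The identity is algebra in the Lie–Rinehart algebra of vector fields over `C^∞(T₀M)`, once a few
facts about `J`, `C` and a spray are known; these facts, collected in `IsSprayAlgebra`, are checked
in charts of `TM`.

Write `β = P d_JP - d_hP`. The projective change gives `h' = h - P J - d_JP ⊗ C` and, by the Hamel
condition, `Φ' = Φ + (P² - S P) J - β ⊗ C` (`jacobi_projective`). Comparing the two isotropy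
conditions yields `α' = α + β + γ`, where `γ` is semi-basic and `c J = γ ⊗ C` for some function `c`.
For `n ≥ 2` the rank of `J` forces `γ = 0`; for `n = 1` it does not, but `d_{h'}γ = 0` holds in
every dimension (`slit_dForm_eq_zero`), and only this is used.

For semi-basic `θ` one has `d_{h'}θ = d_hθ - P d_Jθ - d_JP ∧ 𝓛_Cθ` (`dForm_projective`). The Hamel
condition reads `2 d_hP = d_J(S P)`, so `d_Jd_hP = 0`, and `d_hd_JP = 0` because `[h, J] = 0`. With
`𝓛_Cβ = β` and `d_h²P = d_RP`, the contribution of `β` collapses to `-d_RP`. Finally `Φ` is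
homogeneous, so `μ = 𝓛_Cα - α` is proportional to `C` against `J` (`isotropic_homogeneous`), whence
`μ ∧ d_JP = 0` and `𝓛_Cα` may be replaced by `α`. -/

noncomputable section

namespace SprayGeometry

/-! ### Sprays in Lie–Rinehart algebras -/

section Algebraic

variable {A L : Type*} [CommRing A] [LieRing L] [Module A L]

/-- The algebraic properties of the tangent endomorphism `J`, the Liouville field `C`, a spray `S`
and its horizontal projector `h` as endomorphisms and elements of the module of vector fields. -/
structure IsSprayAlgebra (J h : L →ₗ[A] L) (C S : L) : Prop where
  two_cancel : ∀ X : L, (2 : A) • X = 0 → X = 0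
  sq_eq_zero : ∀ X, J (J X) = 0
  nijenhuis : ∀ X Y, ⁅J X, J Y⁆ = J ⁅J X, Y⁆ + J ⁅X, J Y⁆
  lie_liouville : ∀ X, ⁅C, J X⁆ = J ⁅C, X⁆ - J X
  semispray : J S = C
  homogeneous : ⁅C, S⁆ = S
  vertical : ∀ V, J V = 0 → J ⁅V, S⁆ = V
  two_horiz : ∀ X, (2 : A) • h X = X - ⁅S, J X⁆ + J ⁅S, X⁆

namespace IsSprayAlgebra

variable {J h : L →ₗ[A] L} {C S : L}

lemma cancel (H : IsSprayAlgebra J h C S) {X Y : L} (hXY : (2 : A) • X = (2 : A) • Y) : X = Y := by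
  have := H.two_cancel (X - Y) (by rw [smul_sub, hXY, sub_self])
  exact sub_eq_zero.1 this

lemma J_liouville (H : IsSprayAlgebra J h C S) : J C = 0 := by
  rw [← H.semispray, H.sq_eq_zero]

lemma lie_spray_J (H : IsSprayAlgebra J h C S) (X : L) :
    ⁅S, J X⁆ = X - (2 : A) • h X + J ⁅S, X⁆ := by
  rw [H.two_horiz]; abel

/-- Since `J S = C`, both `nijenhuis` at `S, X` and `lie_liouville` compute `⁅C, J X⁆`; comparing
them gives the claim. -/
lemma J_lie_spray_J (H : IsSprayAlgebra J h C S) (X : L) : J ⁅S, J X⁆ = - J X := by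
  have h1 := H.nijenhuis S X
  have h2 := H.lie_liouville X
  rw [H.semispray] at h1
  rw [h1] at h2
  linear_combination (norm := module) h2

lemma horiz_J (H : IsSprayAlgebra J h C S) (X : L) : h (J X) = 0 := by
  apply H.two_cancel
  rw [H.two_horiz, H.sq_eq_zero, H.J_lie_spray_J, lie_zero]
  abel

lemma J_horiz (H : IsSprayAlgebra J h C S) (X : L) : J (h X) = J X := by
  apply H.cancel
  rw [← map_smul, H.two_horiz]
  simp only [map_add, map_sub, H.sq_eq_zero, H.J_lie_spray_J]
  module

/-- The axiom `vertical` writes `V` as `J ⁅V, S⁆`, so the kernel of `J` equals its image, on which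
`h` vanishes. -/
lemma horiz_vertical (H : IsSprayAlgebra J h C S) {V : L} (hV : J V = 0) : h V = 0 := by
  rw [← H.vertical V hV, H.horiz_J]

lemma horiz_horiz (H : IsSprayAlgebra J h C S) (X : L) : h (h X) = h X := by
  have : h (h X - X) = 0 := H.horiz_vertical (by rw [map_sub, H.J_horiz, sub_self])
  rwa [map_sub, sub_eq_zero] at this

lemma horiz_liouville (H : IsSprayAlgebra J h C S) : h C = 0 := by
  rw [← H.semispray, H.horiz_J]

lemma horiz_spray (H : IsSprayAlgebra J h C S) : h S = S := by
  apply H.cancel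
  rw [H.two_horiz, H.semispray, lie_self, map_zero, ← lie_skew, H.homogeneous]
  module

lemma lie_spray_liouville (H : IsSprayAlgebra J h C S) : ⁅S, C⁆ = - S := by
  rw [← lie_skew, H.homogeneous]

/-- Under `C` the spray has degree `1` and `J` has degree `-1`, so `[S, J]`, and with it `h`, has
degree `0`. -/
lemma lie_liouville_horiz (H : IsSprayAlgebra J h C S)
    (a : ∀ X : L, ⁅C, (2 : A) • X⁆ = (2 : A) • ⁅C, X⁆)
    (X : L) : ⁅C, h X⁆ = h ⁅C, X⁆ := by
  apply H.cancel
  rw [← a, H.two_horiz, H.two_horiz, lie_add, lie_sub, H.lie_liouville, leibniz_lie C S (J X),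
    leibniz_lie C S X, H.homogeneous, H.lie_liouville]
  simp only [map_add, lie_sub]
  abel

/-- Integrability of the vertical distribution: both fields lie in the image of `J`, which is closed
under brackets by `nijenhuis`. -/
lemma J_lie_vertical (H : IsSprayAlgebra J h C S) {V W : L} (hV : J V = 0) (hW : J W = 0) :
    J ⁅V, W⁆ = 0 := by
  rw [← H.vertical V hV, ← H.vertical W hW, H.nijenhuis, map_add, H.sq_eq_zero, H.sq_eq_zero,
    add_zero]

/-- The Frölicher–Nijenhuis bracket `[h, J]` vanishes. -/
lemma bracket_horiz_J (H : IsSprayAlgebra J h C S)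
    (a : ∀ X Y : L, ⁅X, (2 : A) • Y⁆ = (2 : A) • ⁅X, Y⁆) (X Y : L) :
    ⁅h X, J Y⁆ + ⁅J X, h Y⁆ + J ⁅X, Y⁆ - h ⁅J X, Y⁆ - h ⁅X, J Y⁆ - J ⁅h X, Y⁆ - J ⁅X, h Y⁆ = 0 := by
  have a' : ∀ X Y : L, ⁅(2 : A) • X, Y⁆ = (2 : A) • ⁅X, Y⁆ := fun X Y => by
    rw [← lie_skew, a, ← lie_skew X Y, smul_neg]
  -- Differentiate `[J, J] = 0` along `S`. As `[S, J] = Id - 2h` and `[Id, J] = 0`, what remains is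
  -- a multiple of `[h, J]`; `e1` and `e2` absorb the terms in which `S` acts on `X` or `Y`.
  have e := congrArg (fun Z => ⁅S, Z⁆) (H.nijenhuis X Y)
  simp only [lie_add] at e
  rw [leibniz_lie S (J X) (J Y), H.lie_spray_J ⁅J X, Y⁆, H.lie_spray_J ⁅X, J Y⁆,
    leibniz_lie S (J X) Y, leibniz_lie S X (J Y), H.lie_spray_J X, H.lie_spray_J Y] at e
  have e1 := H.nijenhuis ⁅S, X⁆ Y
  have e2 := H.nijenhuis X ⁅S, Y⁆
  have e3 := H.nijenhuis X Y
  simp only [lie_add, lie_sub, add_lie, sub_lie, map_add, map_sub, a, a', map_smul] at e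
  apply H.two_cancel
  linear_combination (norm := module) -e + e1 + e2

lemma form_horiz (H : IsSprayAlgebra J h C S) {θ : L →ₗ[A] A}
    (hθ : ∀ V, J V = 0 → θ V = 0) (X : L) : θ (h X) = θ X := by
  have := hθ (h X - X) (by rw [map_sub, H.J_horiz, sub_self])
  rwa [map_sub, sub_eq_zero] at this

end IsSprayAlgebra

/-! ### Derivatives of forms along vector valued 1-forms -/

section Forms

/-- The left side has the shape of `fnBracket₁₁` with both arguments `h`, where every term occurs
twice. -/
lemma half_curvature {c : A} (hc : 2 * c = 1) (h : L →ₗ[A] L) (X Y : L) :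
    c • (⁅h X, h Y⁆ + ⁅h X, h Y⁆ + h (h ⁅X, Y⁆) + h (h ⁅X, Y⁆)
      - h (⁅h X, Y⁆ + ⁅X, h Y⁆) - h (⁅h X, Y⁆ + ⁅X, h Y⁆)) =
      ⁅h X, h Y⁆ + h (h ⁅X, Y⁆) - h ⁅h X, Y⁆ - h ⁅X, h Y⁆ := by
  have e : ∀ Z : L, (2 * c) • Z = Z := fun Z => by rw [hc, one_smul]
  rw [map_add]
  refine Eq.trans ?_ (e _)
  module

variable [LieRingModule L A]

/-- The 2-form `d_K θ` of a 1-form `θ` along a vector valued 1-form `K`. -/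
def dForm (K : L →ₗ[A] L) (θ : L →ₗ[A] A) (X Y : L) : A :=
  ⁅K X, θ Y⁆ - ⁅K Y, θ X⁆ - θ (⁅K X, Y⁆ + ⁅X, K Y⁆ - K ⁅X, Y⁆)

lemma dForm_add (K : L →ₗ[A] L) (θ η : L →ₗ[A] A) (X Y : L) :
    dForm K (θ + η) X Y = dForm K θ X Y + dForm K η X Y := by
  simp only [dForm, LinearMap.add_apply, lie_add]
  ring

lemma dForm_sub (K : L →ₗ[A] L) (θ η : L →ₗ[A] A) (X Y : L) :
    dForm K (θ - η) X Y = dForm K θ X Y - dForm K η X Y := by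
  simp only [dForm, LinearMap.sub_apply, lie_sub]
  ring

lemma dForm_swap (K : L →ₗ[A] L) (θ : L →ₗ[A] A) (X Y : L) :
    dForm K θ X Y = - dForm K θ Y X := by
  simp only [dForm, map_add, map_sub]
  rw [← lie_skew (K X) Y, ← lie_skew X (K Y), ← lie_skew X Y]
  simp only [map_neg]
  ring

lemma dForm_self (K : L →ₗ[A] L) (θ : L →ₗ[A] A) (X : L) : dForm K θ X X = 0 := by
  simp only [dForm, map_add, map_sub, lie_self, map_zero]
  rw [← lie_skew (K X) X]
  simp only [map_neg]
  ring

lemma dForm_sub_left (K : L →ₗ[A] L) (θ : L →ₗ[A] A) (X X' Y : L) :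
    dForm K θ (X - X') Y = dForm K θ X Y - dForm K θ X' Y := by
  simp only [dForm, map_add, map_sub, sub_lie, lie_sub]
  ring

/-- As `h V = 0` and `θ` is blind to `h`, the value is `θ ⁅V, Y - h Y⁆`, the bracket of two vertical
fields. -/
lemma IsSprayAlgebra.dForm_horiz_vertical {J h : L →ₗ[A] L} {C S : L}
    (H : IsSprayAlgebra J h C S) {θ : L →ₗ[A] A}
    (hθ : ∀ V, J V = 0 → θ V = 0) {V : L} (hV : J V = 0) (Y : L) : dForm h θ V Y = 0 := by
  have h1 := hθ _ (H.J_lie_vertical hV (W := Y - h Y) (by rw [map_sub, H.J_horiz, sub_self]))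
  simp only [dForm, H.horiz_vertical hV, hθ V hV, lie_zero, zero_lie, map_sub, map_add, map_zero,
    H.form_horiz hθ]
  rw [lie_sub, map_sub] at h1
  linear_combination h1

variable [LieRinehartRing A L]

lemma lie_smul_field (x y : L) (a : A) : ⁅x, a • y⁆ = a • ⁅x, y⁆ + ⁅x, a⁆ • y :=
  LieRinehartRing.leibniz_smul_right x y a

lemma smul_field_lie (x y : L) (a : A) : ⁅a • x, y⁆ = a • ⁅x, y⁆ - ⁅y, a⁆ • x := by
  rw [← lie_skew, lie_smul_field, ← lie_skew x y]
  module

lemma lie_mul_fun (x : L) (a b : A) : ⁅x, a * b⁆ = a * ⁅x, b⁆ + ⁅x, a⁆ * b :=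
  LieRinehartRing.leibniz_mul_right x a b

lemma smul_field_lie_fun (x : L) (a b : A) : ⁅a • x, b⁆ = a * ⁅x, b⁆ :=
  LieRinehartRing.lie_smul_eq_mul a b x

lemma lie_one_fun (x : L) : ⁅x, (1 : A)⁆ = 0 := by
  have := lie_mul_fun x (1 : A) 1
  simpa using this

lemma lie_two_fun (x : L) : ⁅x, (2 : A)⁆ = 0 := by
  rw [← one_add_one_eq_two, lie_add, lie_one_fun, add_zero]

lemma lie_two_smul (x y : L) : ⁅x, (2 : A) • y⁆ = (2 : A) • ⁅x, y⁆ := by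
  rw [lie_smul_field, lie_two_fun, zero_smul, add_zero]

/-- The endomorphism `c (Id - [S, J])`, the horizontal projector if `c = 1/2`. -/
def horizEndo (c : A) (J : L →ₗ[A] L) (S : L) : L →ₗ[A] L where
  toFun X := c • (X - ⁅S, J X⁆ + J ⁅S, X⁆)
  map_add' X Y := by
    simp only [map_add, lie_add]
    module
  -- The two brackets contribute the same term `⁅S, f⁆ • J X` with opposite signs.
  map_smul' f X := by
    simp only [map_add, map_smul, lie_smul_field, RingHom.id_apply]
    module

lemma horizEndo_apply (c : A) (J : L →ₗ[A] L) (S X : L) :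
    horizEndo c J S X = c • (X - ⁅S, J X⁆ + J ⁅S, X⁆) := rfl

/-- The 1-form `d_K f`. -/
def dFun (K : L →ₗ[A] L) (f : A) : L →ₗ[A] A where
  toFun X := ⁅K X, f⁆
  map_add' X Y := by rw [map_add, add_lie]
  map_smul' a X := by rw [map_smul, smul_field_lie_fun]; rfl

@[simp] lemma dFun_apply (K : L →ₗ[A] L) (f : A) (X : L) : dFun K f X = ⁅K X, f⁆ := rfl

lemma dForm_smul (K : L →ₗ[A] L) (f : A) (θ : L →ₗ[A] A) (X Y : L) :
    dForm K (f • θ) X Y = f * dForm K θ X Y + ⁅K X, f⁆ * θ Y - ⁅K Y, f⁆ * θ X := by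
  simp only [dForm, LinearMap.smul_apply, smul_eq_mul, lie_mul_fun]
  ring

lemma dForm_smul_left (K : L →ₗ[A] L) (θ : L →ₗ[A] A) (a : A) (X Y : L) :
    dForm K θ (a • X) Y = a * dForm K θ X Y := by
  simp only [dForm, map_add, map_sub, map_smul, smul_field_lie, smul_field_lie_fun, smul_eq_mul,
    lie_mul_fun]
  ring

namespace IsSprayAlgebra

variable {J h h' : L →ₗ[A] L} {C S S' : L}

/-- A semi-basic form `γ` with `c J = γ ⊗ C` has `c² d_h γ = 0`. -/
lemma sq_mul_dForm_eq_zero (H : IsSprayAlgebra J h C S) {γ : L →ₗ[A] A}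
    (hγ : ∀ V, J V = 0 → γ V = 0) {c : A} (hc : ∀ X, c • J X = γ X • C) (X Y : L) :
    c ^ 2 * dForm h γ X Y = 0 := by
  have key : ∀ X Y, c * dForm h γ X Y = γ X * dForm h γ S Y := fun X Y => by
    -- This combination is vertical because `J S = C` and `c J X = γ(X) C`.
    have := H.dForm_horiz_vertical hγ (V := c • X - γ X • S)
      (by rw [map_sub, map_smul, map_smul, hc, H.semispray, sub_self]) Y
    rw [dForm_sub_left, dForm_smul_left, dForm_smul_left] at this
    linear_combination this
  -- A second factor `c` turns `d_hγ(S, Y)` into a multiple of `d_hγ(S, S) = 0`.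
  have h1 := key Y S
  rw [dForm_self] at h1
  have h2 := dForm_swap h γ S Y
  linear_combination c * key X Y + c * γ X * h2 - γ X * h1

/-- The proportionality relation expressing that the Jacobi endomorphism is homogeneous. -/
lemma isotropic_homogeneous (H : IsSprayAlgebra J h C S) {α : L →ₗ[A] A} {ρ : A}
    (hΦ : ∀ X, (⁅S, h X⁆ - h ⁅S, X⁆) - h (⁅S, h X⁆ - h ⁅S, X⁆) = ρ • J X - α X • C) (X : L) :
    (⁅C, ρ⁆ - 2 * ρ) • J X = (⁅C, α X⁆ - α ⁅C, X⁆ - α X) • C := by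
  have hh := H.lie_liouville_horiz (lie_two_smul C)
  -- `Φ` has degree `1`, because `S` has degree `1` and `h` degree `0`. So `⁅C, Φ X⁆ - Φ ⁅C, X⁆ = Φ
  -- X`, and the relation is this identity with `Φ = ρ J - α ⊗ C` inserted.
  have e := congrArg (fun Z => ⁅C, Z⁆) (hΦ X)
  have e1 := hΦ ⁅C, X⁆
  have e2 := hΦ X
  simp only [map_sub, H.horiz_horiz, lie_sub, hh, lie_smul_field, H.lie_liouville, lie_self] at e
  rw [leibniz_lie C S (h X), leibniz_lie C S X, H.homogeneous, hh] at e
  simp only [map_sub, H.horiz_horiz, map_add] at e e1 e2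
  linear_combination (norm := module) -e + e1 + e2

/-! ### Projective deformation by a Hamel function -/

section Projective

variable {P : A}

/-- The horizontal projector of a projectively related spray. -/
lemma horiz_projective (H : IsSprayAlgebra J h C S) (H' : IsSprayAlgebra J h' C S')
    (hS' : S' = S - (2 * P) • C) (X : L) : h' X = h X - P • J X - ⁅J X, P⁆ • C := by
  apply H.cancel
  simp only [smul_sub]
  rw [H.two_horiz, H'.two_horiz, hS']
  simp only [sub_lie, smul_field_lie, map_sub, map_smul, H.J_liouville, H.lie_liouville,
    lie_mul_fun, lie_two_fun]
  module

/-- The change of `d_h θ` for a semi-basic form under a projective deformation of the spray. -/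
lemma dForm_projective (H : IsSprayAlgebra J h C S) (H' : IsSprayAlgebra J h' C S')
    (hS' : S' = S - (2 * P) • C) {θ : L →ₗ[A] A} (hθ : ∀ V, J V = 0 → θ V = 0) (X Y : L) :
    dForm h' θ X Y = dForm h θ X Y - P * dForm J θ X Y
      - ⁅J X, P⁆ * (⁅C, θ Y⁆ - θ ⁅C, Y⁆) + ⁅J Y, P⁆ * (⁅C, θ X⁆ - θ ⁅C, X⁆) := by
  -- Because `θ` kills vertical fields, the summand `d_JP ⊗ C` of `h'` contributes only through
  -- `𝓛_Cθ`.
  have e1 : θ C = 0 := hθ C H.J_liouville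
  have e2 : ∀ X, θ (J X) = 0 := fun X => hθ _ (H.sq_eq_zero X)
  simp only [dForm, H.horiz_projective H' hS', map_add, map_sub, map_smul, lie_sub, sub_lie,
    lie_smul_field, smul_field_lie, smul_field_lie_fun, e1, e2, smul_eq_mul]
  rw [← lie_skew X C, map_neg]
  ring

variable (hP : ∀ X, ⁅S, ⁅J X, P⁆⁆ - ⁅J ⁅S, X⁆, P⁆ - ⁅X, P⁆ = 0) (hCP : ⁅C, P⁆ = P)
include hP

/-- The Hamel condition as `d_J(S P) = 2 d_hP`: commute `S` past `J X` and use `[S, J] = Id - 2h`.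
-/
lemma J_lie_spray_fun (H : IsSprayAlgebra J h C S) (X : L) : ⁅J X, ⁅S, P⁆⁆ = 2 * ⁅h X, P⁆ := by
  have h1 := hP X
  have h2 : ⁅S, ⁅J X, P⁆⁆ = ⁅⁅S, J X⁆, P⁆ + ⁅J X, ⁅S, P⁆⁆ := leibniz_lie S (J X) P
  rw [H.lie_spray_J] at h2
  simp only [add_lie, sub_lie, smul_field_lie_fun] at h2
  linear_combination h1 - h2

/-- Twice `d_hP` is `d_J(S P)`, and `d_J² = 0`. The factor `2` stays because `A` is a general ring.
-/
lemma dForm_J_dFun_horiz (H : IsSprayAlgebra J h C S) (X Y : L) :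
    (2 : A) * dForm J (dFun h P) X Y = 0 := by
  have e := H.J_lie_spray_fun hP
  have h2 : ∀ X Y, (2 : A) * ⁅J X, ⁅h Y, P⁆⁆ = ⁅J X, ⁅J Y, ⁅S, P⁆⁆⁆ := fun X Y => by
    rw [e, lie_mul_fun, lie_two_fun]; ring
  have h1 : ⁅J X, ⁅J Y, ⁅S, P⁆⁆⁆ = ⁅⁅J X, J Y⁆, ⁅S, P⁆⁆ + ⁅J Y, ⁅J X, ⁅S, P⁆⁆⁆ :=
    leibniz_lie (J X) (J Y) ⁅S, P⁆
  rw [H.nijenhuis, add_lie, e ⁅J X, Y⁆, e ⁅X, J Y⁆] at h1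
  simp only [dForm, dFun_apply, map_add, map_sub, H.horiz_J, zero_lie]
  linear_combination h2 X Y - h2 Y X + h1

/-- Since `[h, J] = 0`, the derivations `d_h` and `d_J` anticommute on functions, which reduces this
to `d_Jd_hP`. -/
lemma dForm_horiz_dFun_J (H : IsSprayAlgebra J h C S) (X Y : L) :
    (2 : A) * dForm h (dFun J P) X Y = 0 := by
  have e := H.dForm_J_dFun_horiz hP X Y
  have e1 := congrArg (fun Z : L => ⁅Z, P⁆) (H.bracket_horiz_J lie_two_smul X Y)
  have e2 : ⁅h X, ⁅J Y, P⁆⁆ = ⁅⁅h X, J Y⁆, P⁆ + ⁅J Y, ⁅h X, P⁆⁆ := leibniz_lie _ _ _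
  have e3 : ⁅h Y, ⁅J X, P⁆⁆ = ⁅⁅h Y, J X⁆, P⁆ + ⁅J X, ⁅h Y, P⁆⁆ := leibniz_lie _ _ _
  rw [← lie_skew (h Y) (J X), neg_lie] at e3
  simp only [sub_lie, add_lie, zero_lie] at e1
  simp only [dForm, dFun_apply, map_add, map_sub, H.horiz_J, H.J_horiz, zero_lie] at e ⊢
  linear_combination -e + 2 * e1 + 2 * e2 - 2 * e3

include hCP

/-- The Jacobi endomorphism of the projective deformation of a spray by a Hamel function. -/
lemma jacobi_projective (H : IsSprayAlgebra J h C S) (H' : IsSprayAlgebra J h' C S')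
    (hS' : S' = S - (2 * P) • C) (X : L) :
    (⁅S', h' X⁆ - h' ⁅S', X⁆) - h' (⁅S', h' X⁆ - h' ⁅S', X⁆) =
      (⁅S, h X⁆ - h ⁅S, X⁆) - h (⁅S, h X⁆ - h ⁅S, X⁆) + (P ^ 2 - ⁅S, P⁆) • J X
        - (P * ⁅J X, P⁆ - ⁅h X, P⁆) • C := by
  have hh := H.lie_liouville_horiz (lie_two_smul C)
  have e1 : ⁅C, ⁅J X, P⁆⁆ = ⁅J ⁅C, X⁆, P⁆ := by
    have : ⁅C, ⁅J X, P⁆⁆ = ⁅⁅C, J X⁆, P⁆ + ⁅J X, ⁅C, P⁆⁆ := leibniz_lie _ _ _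
    rw [this, hCP, H.lie_liouville, sub_lie]; ring
  have e2 := hP X
  have e3 : J ⁅S, h X⁆ = X - h X + J ⁅S, X⁆ := by
    have := H.lie_spray_J (h X)
    rw [H.J_horiz, H.lie_spray_J, H.horiz_horiz] at this
    linear_combination (norm := module) -this
  have e4 : ∀ Z, (Z - h' Z) = Z - h Z + P • J Z + ⁅J Z, P⁆ • C := fun Z => by
    rw [H.horiz_projective H' hS']; abel
  -- Vertical projection removes `h' ⁅S', X⁆` and `h ⁅S, X⁆`, so only `⁅S', h' X⁆` and `⁅S, h X⁆`
  -- need to be compared. By `e4`, this requires the images of `⁅S', h' X⁆` under `J` and `h`, found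
  -- in `e8` and `e11`.
  have e5 : h' ⁅S', X⁆ - h' (h' ⁅S', X⁆) = 0 := by rw [H'.horiz_horiz, sub_self]
  have e6 : h ⁅S, X⁆ - h (h ⁅S, X⁆) = 0 := by rw [H.horiz_horiz, sub_self]
  have e7 : ⁅S', h' X⁆ = ⁅S, h X⁆ - ⁅S, P⁆ • J X - P • (X - (2 : A) • h X + J ⁅S, X⁆)
      - ⁅S, ⁅J X, P⁆⁆ • C + ⁅J X, P⁆ • S - (2 * P) • h ⁅C, X⁆ + (2 * ⁅h X, P⁆) • C
      + (2 * P ^ 2) • J ⁅C, X⁆ - (4 * P * ⁅J X, P⁆) • C + (2 * P * ⁅J ⁅C, X⁆, P⁆) • C := by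
    rw [H.horiz_projective H' hS', hS']
    simp only [sub_lie, lie_sub, smul_field_lie, lie_smul_field, lie_self, H.lie_spray_liouville,
      H.lie_spray_J, hh, H.lie_liouville, e1, hCP, smul_field_lie_fun, lie_mul_fun, lie_two_fun]
    module
  have e8 : J ⁅S', h' X⁆ = X - h X + J ⁅S, X⁆ + P • J X + ⁅J X, P⁆ • C - (2 * P) • J ⁅C, X⁆ := by
    rw [e7]
    simp only [map_add, map_sub, map_smul, e3, H.sq_eq_zero, H.J_liouville, H.semispray, H.J_horiz]
    module
  have e9 := e4 ⁅S', h' X⁆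
  rw [e8] at e9
  -- The Hamel condition removes the second derivatives of `P` from the coefficient of `C`.
  have e10 : ⁅X, P⁆ = ⁅S, ⁅J X, P⁆⁆ - ⁅J ⁅S, X⁆, P⁆ := by linear_combination -e2
  have e11 : h ⁅S', h' X⁆ = h ⁅S, h X⁆ - P • (h ⁅S, X⁆ - h ⁅S, X⁆ - h X)
      + ⁅J X, P⁆ • S - (2 * P) • h ⁅C, X⁆ := by
    rw [e7]
    simp only [map_add, map_sub, map_smul, H.horiz_horiz, H.horiz_J, H.horiz_liouville,
      H.horiz_spray]
    module
  rw [e11] at e9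
  simp only [add_lie, sub_lie, smul_field_lie_fun, hCP, e10] at e9
  simp only [map_sub]
  linear_combination (norm := module) e9 + e7 - e5 + e6

/-- The effect of a projective deformation by a Hamel function on the derivative `d_h α`. -/
lemma dForm_projective_isotropic (H : IsSprayAlgebra J h C S) (H' : IsSprayAlgebra J h' C S')
    (two : ∀ a : A, 2 * a = 0 → a = 0)
    (hS' : S' = S - (2 * P) • C) {α α' γ : L →ₗ[A] A} (hα : ∀ V, J V = 0 → α V = 0)
    (hα' : ∀ X, α' X = α X + (P * ⁅J X, P⁆ - ⁅h X, P⁆) + γ X)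
    (hγ : ∀ X Y, dForm h' γ X Y = 0)
    (hμ : ∀ X Y, (⁅C, α X⁆ - α ⁅C, X⁆ - α X) • J Y = (⁅C, α Y⁆ - α ⁅C, Y⁆ - α Y) • J X)
    (X Y : L) :
    dForm h' α' X Y = dForm h α X Y
      - ⁅⁅h X, h Y⁆ + h (h ⁅X, Y⁆) - h ⁅h X, Y⁆ - h ⁅X, h Y⁆, P⁆
      - P * dForm J α X Y + (α X * ⁅J Y, P⁆ - α Y * ⁅J X, P⁆) := by
  have hh := H.lie_liouville_horiz (lie_two_smul C)
  obtain rfl : α' = α + (P • dFun J P - dFun h P) + γ := by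
    ext X
    simp [hα']
  have hβ : ∀ V, J V = 0 → (P • dFun J P - dFun h P) V = 0 := fun V hV => by
    simp [hV, H.horiz_vertical hV]
  -- `𝓛_Cβ = β`: under `C`, `P` and `d_hP` have degree `1`, while `d_JP` has degree `0`.
  have hβC : ∀ X, ⁅C, (P • dFun J P - dFun h P) X⁆ - (P • dFun J P - dFun h P) ⁅C, X⁆
      = (P • dFun J P - dFun h P) X := fun X => by
    have e1 : ⁅C, ⁅J X, P⁆⁆ = ⁅⁅C, J X⁆, P⁆ + ⁅J X, ⁅C, P⁆⁆ := leibniz_lie _ _ _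
    have e2 : ⁅C, ⁅h X, P⁆⁆ = ⁅⁅C, h X⁆, P⁆ + ⁅h X, ⁅C, P⁆⁆ := leibniz_lie _ _ _
    rw [hCP, H.lie_liouville, sub_lie] at e1
    rw [hCP, hh] at e2
    simp only [LinearMap.sub_apply, LinearMap.smul_apply, dFun_apply, smul_eq_mul, lie_sub,
      lie_mul_fun, hCP, e1, e2]
    ring
  have e3 := two _ (H.dForm_J_dFun_horiz hP X Y)
  have e4 := two _ (H.dForm_horiz_dFun_J hP X Y)
  have e5 : dForm J (dFun J P) X Y = 0 := by
    have : ⁅J X, ⁅J Y, P⁆⁆ = ⁅⁅J X, J Y⁆, P⁆ + ⁅J Y, ⁅J X, P⁆⁆ := leibniz_lie _ _ _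
    rw [H.nijenhuis, add_lie] at this
    simp only [dForm, dFun_apply, map_add, map_sub, H.sq_eq_zero, zero_lie]
    linear_combination this
  have e6 : dForm h (dFun h P) X Y
      = ⁅⁅h X, h Y⁆ + h (h ⁅X, Y⁆) - h ⁅h X, Y⁆ - h ⁅X, h Y⁆, P⁆ := by
    have : ⁅h X, ⁅h Y, P⁆⁆ = ⁅⁅h X, h Y⁆, P⁆ + ⁅h Y, ⁅h X, P⁆⁆ := leibniz_lie _ _ _
    simp only [dForm, dFun_apply, map_add, map_sub, add_lie, sub_lie]
    linear_combination this
  -- Applied to `P`, the symmetry `hμ` says `(𝓛_Cα - α) ∧ d_JP = 0`.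
  have e7 := congrArg (fun Z : L => ⁅Z, P⁆) (hμ X Y)
  simp only [smul_field_lie_fun] at e7
  -- The term `d_hP ∧ d_JP` of `d_h(P d_JP)` cancels against `-d_JP ∧ β = d_JP ∧ d_hP`.
  rw [dForm_add, dForm_add, hγ, H.dForm_projective H' hS' hα,
    H.dForm_projective H' hS' hβ, hβC, hβC, dForm_sub, dForm_sub, dForm_smul, dForm_smul,
    e3, e4, e5, e6]
  simp only [LinearMap.sub_apply, LinearMap.smul_apply, dFun_apply, smul_eq_mul]
  linear_combination e7

end Projective

end IsSprayAlgebra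

end Forms

end Algebraic

end SprayGeometry

end

noncomputable section

namespace SprayGeometry

/-! ### The canonical structures of the tangent bundle in charts -/

section Charts

open Bundle Filter
open scoped Topology

variable {n : ℕ} {M : Type*} [TopologicalSpace M] [ChartedSpace (EuclideanSpace ℝ (Fin n)) M]
  [IsManifold (𝓡 n) ∞ M]

local notation "𝔼" => EuclideanSpace ℝ (Fin n)
local notation "TM" => TangentBundle (𝓡 n) M

instance isManifold_one_of_infty : IsManifold (𝓡 n) 1 M := IsManifold.of_le (n := ∞) (by simp)

/-- The derivative at `q` of the chart of `TM` around `p`. -/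
def chartD (p q : TM) : TangentSpace (𝓡 n).tangent q →L[ℝ] 𝔼 × 𝔼 :=
  mvfderiv (𝓡 n).tangent (extChartAt (𝓡 n).tangent p) q

lemma mem_chart_source_of_base {p q : TM} (hq : q.1 ∈ (chartAt 𝔼 p.1).source) :
    q ∈ (chartAt (ModelProd 𝔼 𝔼) p).source := by
  simpa using hq

/-- The tangent space at `p` is the model space, identified through the preferred chart at `p`;
pointwise identities at `p` thus become identities of pairs. -/
lemma chartD_self (p : TM) (w : TangentSpace (𝓡 n).tangent p) : chartD p p w = w := by
  have : mfderiv (𝓡 n).tangent 𝓘(ℝ, 𝔼 × 𝔼) (extChartAt (𝓡 n).tangent p) p =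
    ContinuousLinearMap.id ℝ _ := mfderiv_extChartAt_self
  simp only [chartD, mvfderiv]
  erw [this]
  rfl

lemma extChartAt_tangent_apply {p q : TM} (hq : q.1 ∈ (chartAt 𝔼 p.1).source) :
    extChartAt (𝓡 n).tangent p q =
      (extChartAt (𝓡 n) p.1 q.1, mvfderiv (𝓡 n) (extChartAt (𝓡 n) p.1) q.1 q.2) := by
  have := TangentBundle.continuousLinearMapAt_trivializationAt (I := 𝓡 n) hq
  have h2 := congrArg (fun f => f q.2) this
  have h3 : extChartAt (𝓡 n).tangent p q = (extChartAt (𝓡 n) p.1 q.1,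
    (trivializationAt 𝔼 (TangentSpace (𝓡 n)) p.1 q).2) := by
    have := FiberBundle.extChartAt (IB := 𝓡 n) (F := 𝔼) (E := (TangentSpace (𝓡 n) : M → Type _)) p
    erw [this]
    rfl
  rw [h3]
  refine Prod.ext rfl ?_
  refine Eq.trans ?_ h2
  simp only
  rw [Trivialization.continuousLinearMapAt_apply, Trivialization.linearMapAt_apply, if_pos]
  · simpa using hq

lemma mdifferentiableAt_fiber_line (q : TM) (u : TangentSpace (𝓡 n) q.1) :
    MDifferentiableAt 𝓘(ℝ, ℝ) (𝓡 n).tangent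
      (fun t : ℝ => (⟨q.1, q.2 + t • u⟩ : TM)) 0 := by
  have : ContMDiffAt 𝓘(ℝ, ℝ) (𝓡 n).tangent 1 (fun t : ℝ => (⟨q.1, q.2 + t • u⟩ : TM)) 0 := by
    refine Bundle.contMDiffAt_totalSpace.2 ⟨contMDiffAt_const, ?_⟩
    have h : ∀ t : ℝ, (trivializationAt 𝔼 (TangentSpace (𝓡 n)) q.1 ⟨q.1, q.2 + t • u⟩).2 =
      (trivializationAt 𝔼 (TangentSpace (𝓡 n)) q.1).continuousLinearMapAt ℝ q.1 q.2 +
      t • (trivializationAt 𝔼 (TangentSpace (𝓡 n)) q.1).continuousLinearMapAt ℝ q.1 u := by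
      intro t
      rw [← map_smul, ← map_add]
      rw [Trivialization.continuousLinearMapAt_apply, Trivialization.linearMapAt_apply, if_pos]
      simp
    have : ContDiff ℝ 1 (fun t : ℝ =>
       (trivializationAt 𝔼 (TangentSpace (𝓡 n)) q.1).continuousLinearMapAt ℝ q.1 q.2 +
      t • (trivializationAt 𝔼 (TangentSpace (𝓡 n)) q.1).continuousLinearMapAt ℝ q.1 u) := by
      fun_prop
    refine ContMDiffAt.congr_of_eventuallyEq this.contMDiff.contMDiffAt (Eventually.of_forall ?_)
    intro t
    simp only [h]
  exact this.mdifferentiableAt one_ne_zero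

lemma chartD_vlift {p q : TM} (hq : q.1 ∈ (chartAt 𝔼 p.1).source) (u : TangentSpace (𝓡 n) q.1) :
    chartD p q (vlift q u) = (0, mvfderiv (𝓡 n) (extChartAt (𝓡 n) p.1) q.1 u) := by
  have h1 : MDifferentiableAt (𝓡 n).tangent 𝓘(ℝ, 𝔼 × 𝔼) (extChartAt (𝓡 n).tangent p)
      ((fun t : ℝ => (⟨q.1, q.2 + t • u⟩ : TM)) 0) :=
    mdifferentiableAt_extChartAt (mem_chart_source_of_base hq)
  have h2 := mfderiv_comp (0:ℝ) h1 (mdifferentiableAt_fiber_line q u)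
  have h3 : (extChartAt (𝓡 n).tangent p) ∘ (fun t : ℝ => (⟨q.1, q.2 + t • u⟩ : TM)) =
      fun t : ℝ => (extChartAt (𝓡 n) p.1 q.1,
        mvfderiv (𝓡 n) (extChartAt (𝓡 n) p.1) q.1 q.2 +
        t • mvfderiv (𝓡 n) (extChartAt (𝓡 n) p.1) q.1 u) := by
    funext t
    simp only [Function.comp]
    rw [extChartAt_tangent_apply (by simpa using hq)]
    simp
  rw [h3, mfderiv_eq_fderiv] at h2
  have h4 : HasDerivAt (fun t : ℝ => (extChartAt (𝓡 n) p.1 q.1,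
        mvfderiv (𝓡 n) (extChartAt (𝓡 n) p.1) q.1 q.2 +
        t • mvfderiv (𝓡 n) (extChartAt (𝓡 n) p.1) q.1 u))
        ((0 : 𝔼), mvfderiv (𝓡 n) (extChartAt (𝓡 n) p.1) q.1 u) 0 := by
    refine (hasDerivAt_const _ _).prodMk ?_
    simpa using! ((hasDerivAt_id (0:ℝ)).smul_const
      (mvfderiv (𝓡 n) (extChartAt (𝓡 n) p.1) q.1 u)).const_add
        (mvfderiv (𝓡 n) (extChartAt (𝓡 n) p.1) q.1 q.2)
  rw [h4.hasFDerivAt.fderiv] at h2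
  have h5 := congrArg (fun f => f (1 : ℝ)) h2.symm
  refine Eq.trans ?_ (h5.trans ?_)
  · have hq0 : q = (⟨q.1, q.2 + (0 : ℝ) • u⟩ : TM) := by simp
    exact congrArg (fun r : TM =>
      (mfderiv (𝓡 n).tangent 𝓘(ℝ, 𝔼 × 𝔼) (extChartAt (𝓡 n).tangent p) r : 𝔼 × 𝔼 →L[ℝ] 𝔼 × 𝔼)
        (vlift q u)) hq0
  · exact one_smul ℝ ((0 : 𝔼), mvfderiv (𝓡 n) (extChartAt (𝓡 n) p.1) q.1 u)

lemma chartD_fst {p q : TM} (hq : q.1 ∈ (chartAt 𝔼 p.1).source)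
    (w : TangentSpace (𝓡 n).tangent q) :
    (chartD p q w).1 = mvfderiv (𝓡 n) (extChartAt (𝓡 n) p.1) q.1 (dproj q w) := by
  have h1 : MDifferentiableAt (𝓡 n).tangent 𝓘(ℝ, 𝔼 × 𝔼) (extChartAt (𝓡 n).tangent p) q :=
    mdifferentiableAt_extChartAt (mem_chart_source_of_base hq)
  have h2 : MDifferentiableAt (𝓡 n).tangent (𝓡 n) (fun q : TM => q.1) q :=
    (contMDiff_proj (n := 1) (TangentSpace (𝓡 n))).contMDiffAt.mdifferentiableAt one_ne_zero
  have h3 : MDifferentiableAt (𝓡 n) 𝓘(ℝ, 𝔼) (extChartAt (𝓡 n) p.1) q.1 :=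
    mdifferentiableAt_extChartAt hq
  have h4 := mfderiv_comp q h3 h2
  have h5 : MDifferentiableAt 𝓘(ℝ, 𝔼 × 𝔼) 𝓘(ℝ, 𝔼) (Prod.fst : 𝔼 × 𝔼 → 𝔼)
    (extChartAt (𝓡 n).tangent p q) := differentiableAt_fst.mdifferentiableAt
  have h6 := mfderiv_comp q h5 h1
  have h7 : (extChartAt (𝓡 n) p.1) ∘ (fun q : TM => q.1) =
    Prod.fst ∘ (extChartAt (𝓡 n).tangent p) := by
    funext q
    rfl
  rw [← h7, h4, mfderiv_eq_fderiv, fderiv_fst] at h6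
  exact congrArg (fun f => f w) h6.symm

/-- The coordinate form `(a, b) ↦ (0, a)` of `J` holds throughout the chart domain, so it can be
differentiated at `p`. -/
lemma chartD_tangentEndo {p q : TM} (hq : q.1 ∈ (chartAt 𝔼 p.1).source)
    (X : VField n M) : chartD p q (tangentEndo X q) = (0, (chartD p q (X q)).1) := by
  rw [tangentEndo, chartD_vlift hq, chartD_fst hq]

lemma chartD_liouville {p q : TM} (hq : q.1 ∈ (chartAt 𝔼 p.1).source) :
    chartD p q (liouville q) = (0, (extChartAt (𝓡 n).tangent p q).2) := by
  rw [liouville, chartD_vlift hq, extChartAt_tangent_apply hq]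

lemma tangentEndo_self (X : VField n M) (p : TM) :
    tangentEndo X p = ((0, (X p : 𝔼 × 𝔼).1) : 𝔼 × 𝔼) := by
  have := chartD_tangentEndo (p := p) (q := p) (by simp) X
  simpa only [chartD_self] using! this

/-- Links the kernel of `dπ`, used to define semi-basic forms, with the kernel of `J`: the first
chart component of a vector is its projection under an invertible map. -/
lemma dproj_eq_zero_of_tangentEndo {X : VField n M} {p : TM} (h : tangentEndo X p = 0) :
    dproj p (X p) = 0 := by
  have h1 := chartD_fst (p := p) (q := p) (by simp) (X p)
  have h2 : (chartD p p (X p)).1 = 0 := by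
    have := chartD_tangentEndo (p := p) (q := p) (by simp) X
    rw [h, map_zero] at this
    exact (congrArg Prod.snd this).symm
  rw [h2] at h1
  have h3 : (mfderiv (𝓡 n) 𝓘(ℝ, 𝔼) (extChartAt (𝓡 n) p.1) p.1).IsInvertible :=
    isInvertible_mfderiv_extChartAt (by simp)
  exact h3.injective (h1.symm.trans (map_zero (mvfderiv (𝓡 n) (extChartAt (𝓡 n) p.1) p.1)).symm)

lemma liouville_ne_zero {p : TM} (hp : p ∈ slit n M) : liouville p ≠ 0 := by
  intro h
  have h1 := chartD_vlift (p := p) (q := p) (by simp) p.2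
  have h2 : vlift p p.2 = 0 := h
  rw [h2, map_zero] at h1
  have h3 : (mfderiv (𝓡 n) 𝓘(ℝ, 𝔼) (extChartAt (𝓡 n) p.1) p.1).IsInvertible :=
    isInvertible_mfderiv_extChartAt (by simp)
  exact hp (h3.injective ((congrArg Prod.snd h1).symm.trans
    (map_zero (mvfderiv (𝓡 n) (extChartAt (𝓡 n) p.1) p.1)).symm))

lemma isOpen_slit : IsOpen (slit n M) := by
  rw [isOpen_iff_mem_nhds]
  intro p hp
  have h1 : ∀ q : TM, q.1 ∈ (chartAt 𝔼 p.1).source →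
      (q.2 ≠ 0 ↔ (extChartAt (𝓡 n).tangent p q).2 ≠ 0) := fun q hq => by
    rw [extChartAt_tangent_apply hq, not_iff_not]
    have h3 : (mfderiv (𝓡 n) 𝓘(ℝ, 𝔼) (extChartAt (𝓡 n) p.1) q.1).IsInvertible :=
      isInvertible_mfderiv_extChartAt (by simpa using hq)
    constructor
    · intro h
      simp [h]
    · intro h
      exact h3.injective (h.trans (map_zero (mvfderiv (𝓡 n) (extChartAt (𝓡 n) p.1) q.1)).symm)
  have hcont : ContinuousAt (fun q => (extChartAt (𝓡 n).tangent p q).2) p :=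
    continuous_snd.continuousAt.comp (continuousAt_extChartAt p)
  have h2 := hcont.eventually_ne ((h1 p (by simp)).1 hp)
  filter_upwards [h2, (chartAt (ModelProd 𝔼 𝔼) p).open_source.mem_nhds (mem_chart_source _ p)]
    with q hq hq'
  exact (h1 q (by simpa using hq')).2 hq

/-- A vector field in the chart of `TM` around `p`. -/
def chartRepr (X : VField n M) (p : TM) (z : 𝔼 × 𝔼) : 𝔼 × 𝔼 :=
  chartD p ((extChartAt (𝓡 n).tangent p).symm z) (X ((extChartAt (𝓡 n).tangent p).symm z))

lemma base_symm_mem {p : TM} {z : 𝔼 × 𝔼} (hz : z ∈ (extChartAt (𝓡 n).tangent p).target) :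
    ((extChartAt (𝓡 n).tangent p).symm z).1 ∈ (chartAt 𝔼 p.1).source := by
  have := (extChartAt (𝓡 n).tangent p).map_target hz
  rw [extChartAt_source] at this
  simpa using this

lemma chartRepr_tangentEndo (X : VField n M) (p : TM) {z : 𝔼 × 𝔼}
    (hz : z ∈ (extChartAt (𝓡 n).tangent p).target) :
    chartRepr (tangentEndo X) p z = (0, (chartRepr X p z).1) :=
  chartD_tangentEndo (base_symm_mem hz) X

lemma chartRepr_liouville (p : TM) {z : 𝔼 × 𝔼} (hz : z ∈ (extChartAt (𝓡 n).tangent p).target) :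
    chartRepr (liouville (n := n) (M := M)) p z = (0, z.2) := by
  rw [chartRepr, chartD_liouville (base_symm_mem hz), (extChartAt (𝓡 n).tangent p).right_inv hz]

lemma chartRepr_self (X : VField n M) (p : TM) :
    chartRepr X p (extChartAt (𝓡 n).tangent p p) = X p := by
  unfold chartRepr
  rw [extChartAt_to_inv]
  exact chartD_self p (X p)

lemma target_mem_nhds (p : TM) : (extChartAt (𝓡 n).tangent p).target ∈
    𝓝 (extChartAt (𝓡 n).tangent p p) := extChartAt_target_mem_nhds p

lemma mpullbackWithin_eq_chartRepr (X : VField n M) (p : TM) {z : 𝔼 × 𝔼}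
    (hz : z ∈ (extChartAt (𝓡 n).tangent p).target) :
    VectorField.mpullbackWithin 𝓘(ℝ, 𝔼 × 𝔼) (𝓡 n).tangent (extChartAt (𝓡 n).tangent p).symm X
      (Set.range (𝓡 n).tangent) z = chartRepr X p z := by
  rw [VectorField.mpullbackWithin_apply]
  have h1 := mfderiv_extChartAt_comp_mfderivWithin_extChartAt_symm hz
  have h2 := mfderivWithin_extChartAt_symm_comp_mfderiv_extChartAt hz
  rw [ContinuousLinearMap.inverse_eq h2 h1]
  rfl

/-- The chart at `p` has identity derivative there, so the bracket of the representatives needs no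
transport back. -/
lemma lie_apply (X Y : VField n M) (p : TM) :
    lie X Y p = VectorField.lieBracket ℝ (chartRepr X p) (chartRepr Y p)
      (extChartAt (𝓡 n).tangent p p) := by
  unfold lie
  rw [← VectorField.mlieBracketWithin_univ, VectorField.mlieBracketWithin_apply]
  have hr : ((extChartAt (𝓡 n).tangent p).symm ⁻¹' Set.univ ∩ Set.range (𝓡 n).tangent
      : Set (𝔼 × 𝔼)) = Set.univ := by simp
  have hid : mfderiv (𝓡 n).tangent 𝓘(ℝ, 𝔼 × 𝔼) (extChartAt (𝓡 n).tangent p) p =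
    ContinuousLinearMap.id ℝ (𝔼 × 𝔼) := mfderiv_extChartAt_self
  rw [hid, hr]
  change (ContinuousLinearMap.id ℝ (𝔼 × 𝔼)).inverse (VectorField.lieBracketWithin ℝ (E := 𝔼 × 𝔼)
    (VectorField.mpullbackWithin 𝓘(ℝ, 𝔼 × 𝔼) (𝓡 n).tangent (extChartAt (𝓡 n).tangent p).symm X
      (Set.range (𝓡 n).tangent))
    (VectorField.mpullbackWithin 𝓘(ℝ, 𝔼 × 𝔼) (𝓡 n).tangent (extChartAt (𝓡 n).tangent p).symm Y
      (Set.range (𝓡 n).tangent)) Set.univ (extChartAt (𝓡 n).tangent p p)) = _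
  rw [ContinuousLinearMap.inverse_id, ContinuousLinearMap.id_apply]
  refine (congrFun (VectorField.lieBracketWithin_univ (𝕜 := ℝ) (E := 𝔼 × 𝔼)) _).trans ?_
  refine Filter.EventuallyEq.lieBracket_vectorField_eq ?_ ?_
  · filter_upwards [target_mem_nhds p] with z hz using mpullbackWithin_eq_chartRepr X p hz
  · filter_upwards [target_mem_nhds p] with z hz using mpullbackWithin_eq_chartRepr Y p hz

lemma SmoothField.contMDiffAt {X : VField n M} (hX : SmoothField X) {p : TM} (hp : p ∈ slit n M) :
    ContMDiffAt (𝓡 n).tangent (𝓡 n).tangent.tangent ∞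
      (fun p => (⟨p, X p⟩ : TangentBundle (𝓡 n).tangent (TangentBundle (𝓡 n) M))) p :=
  ContMDiffOn.contMDiffAt hX (isOpen_slit.mem_nhds hp)

lemma SmoothField.differentiableAt_chartRepr {X : VField n M} (hX : SmoothField X) {p : TM}
    (hp : p ∈ slit n M) :
    DifferentiableAt ℝ (chartRepr X p) (extChartAt (𝓡 n).tangent p p) := by
  have h1 := (hX.contMDiffAt hp).mdifferentiableAt (by simp)
  have : IsManifold (𝓡 n).tangent 2 TM :=
    IsManifold.of_le (n := ∞) (WithTop.coe_le_coe.2 le_top)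
  have h2 := (h1.mdifferentiableWithinAt
    (s := Set.univ)).differentiableWithinAt_mpullbackWithin_vectorField
  have hr : ((extChartAt (𝓡 n).tangent p).symm ⁻¹' Set.univ ∩ Set.range (𝓡 n).tangent
      : Set (𝔼 × 𝔼)) = Set.univ := by simp
  erw [hr, differentiableWithinAt_univ] at h2
  refine h2.congr_of_eventuallyEq ?_
  filter_upwards [target_mem_nhds p] with z hz using (mpullbackWithin_eq_chartRepr X p hz).symm

/-- The tangent endomorphism of the model space. -/
def modelJ (n : ℕ) : EuclideanSpace ℝ (Fin n) × EuclideanSpace ℝ (Fin n) →L[ℝ]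
    EuclideanSpace ℝ (Fin n) × EuclideanSpace ℝ (Fin n) :=
  (ContinuousLinearMap.inr ℝ _ _).comp (ContinuousLinearMap.fst ℝ _ _)

/-- The Liouville field of the model space. -/
def modelC (n : ℕ) : EuclideanSpace ℝ (Fin n) × EuclideanSpace ℝ (Fin n) →L[ℝ]
    EuclideanSpace ℝ (Fin n) × EuclideanSpace ℝ (Fin n) :=
  (ContinuousLinearMap.inr ℝ _ _).comp (ContinuousLinearMap.snd ℝ _ _)

lemma modelJ_apply (z : 𝔼 × 𝔼) : modelJ n z = (0, z.1) := rfl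

lemma modelC_apply (z : 𝔼 × 𝔼) : modelC n z = (0, z.2) := rfl

lemma chartRepr_tangentEndo_eventuallyEq (X : VField n M) (p : TM) :
    chartRepr (tangentEndo X) p =ᶠ[𝓝 (extChartAt (𝓡 n).tangent p p)]
      fun z => modelJ n (chartRepr X p z) := by
  filter_upwards [target_mem_nhds p] with z hz using chartRepr_tangentEndo X p hz

lemma chartRepr_liouville_eventuallyEq (p : TM) :
    chartRepr (liouville (n := n) (M := M)) p =ᶠ[𝓝 (extChartAt (𝓡 n).tangent p p)]
      fun z => modelC n z := by
  filter_upwards [target_mem_nhds p] with z hz using chartRepr_liouville p hz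

lemma hasFDerivAt_chartRepr_tangentEndo {X : VField n M} (hX : SmoothField X) {p : TM}
    (hp : p ∈ slit n M) :
    HasFDerivAt (chartRepr (tangentEndo X) p)
      ((modelJ n).comp (fderiv ℝ (chartRepr X p) (extChartAt (𝓡 n).tangent p p)))
      (extChartAt (𝓡 n).tangent p p) :=
  ((modelJ n).hasFDerivAt.comp _ (hX.differentiableAt_chartRepr hp).hasFDerivAt).congr_of_eventuallyEq
    (chartRepr_tangentEndo_eventuallyEq X p)

lemma hasFDerivAt_chartRepr_liouville (p : TM) :
    HasFDerivAt (chartRepr (liouville (n := n) (M := M)) p) (modelC n)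
      (extChartAt (𝓡 n).tangent p p) :=
  (modelC n).hasFDerivAt.congr_of_eventuallyEq (chartRepr_liouville_eventuallyEq p)

/-- `J` has constant coefficients in the chart, so it passes through derivatives; the remaining
discrepancy vanishes by `J² = 0`. -/
lemma lie_tangentEndo_tangentEndo {X Y : VField n M} (hX : SmoothField X) (hY : SmoothField Y)
    {p : TM} (hp : p ∈ slit n M) :
    lie (tangentEndo X) (tangentEndo Y) p =
      tangentEndo (lie (tangentEndo X) Y) p + tangentEndo (lie X (tangentEndo Y)) p := by
  rw [tangentEndo_self, tangentEndo_self, lie_apply, lie_apply, lie_apply]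
  simp only [VectorField.lieBracket, (hasFDerivAt_chartRepr_tangentEndo hX hp).fderiv,
    (hasFDerivAt_chartRepr_tangentEndo hY hp).fderiv,
    (chartRepr_tangentEndo_eventuallyEq X p).eq_of_nhds,
    (chartRepr_tangentEndo_eventuallyEq Y p).eq_of_nhds]
  refine Prod.ext ?_ ?_
  · simp only [ContinuousLinearMap.comp_apply, modelJ_apply, Prod.fst_sub, sub_self]
    exact (add_zero (0 : 𝔼)).symm
  · simp only [ContinuousLinearMap.comp_apply, modelJ_apply, Prod.fst_sub, Prod.snd_sub, sub_zero,
      zero_sub]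
    exact sub_eq_add_neg _ _

lemma lie_liouville_tangentEndo {X : VField n M} (hX : SmoothField X)
    {p : TM} (hp : p ∈ slit n M) :
    lie liouville (tangentEndo X) p = tangentEndo (lie liouville X) p - tangentEndo X p := by
  rw [tangentEndo_self, tangentEndo_self, lie_apply, lie_apply, ← chartRepr_self X p]
  simp only [VectorField.lieBracket, (hasFDerivAt_chartRepr_tangentEndo hX hp).fderiv,
    (hasFDerivAt_chartRepr_liouville p).fderiv,
    (chartRepr_tangentEndo_eventuallyEq X p).eq_of_nhds]
  refine Prod.ext ?_ ?_
  · simp only [ContinuousLinearMap.comp_apply, modelJ_apply, modelC_apply, Prod.fst_sub, sub_self]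
    exact (sub_zero (0 : 𝔼)).symm
  · simp only [ContinuousLinearMap.comp_apply, modelJ_apply, modelC_apply, Prod.fst_sub,
      Prod.snd_sub, sub_zero]
    rfl

/-- In coordinates `V = (0, b)` and `S = (y, g)`, so the first component of `[V, S]` is the
derivative of `y` along `V`, which is `b`. -/
lemma tangentEndo_lie_vertical {V S : VField n M} (hV : SmoothField V) (hS : SmoothField S)
    (hV0 : ∀ p ∈ slit n M, tangentEndo V p = 0)
    (hSC : ∀ p ∈ slit n M, tangentEndo S p = liouville p) {p : TM} (hp : p ∈ slit n M) :
    tangentEndo (lie V S) p = V p := by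
  have hslit : ∀ᶠ z in 𝓝 (extChartAt (𝓡 n).tangent p p),
      (extChartAt (𝓡 n).tangent p).symm z ∈ slit n M := by
    have := (continuousAt_extChartAt_symm (I := (𝓡 n).tangent) p)
    refine this.eventually_mem ?_
    rw [extChartAt_to_inv]
    exact isOpen_slit.mem_nhds hp
  have h1 : (fun z => modelJ n (chartRepr V p z)) =ᶠ[𝓝 (extChartAt (𝓡 n).tangent p p)]
      fun _ => 0 := by
    filter_upwards [hslit, chartRepr_tangentEndo_eventuallyEq V p] with z hz hz'
    rw [← hz', chartRepr, hV0 _ hz, map_zero]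
  have h2 : (fun z => modelJ n (chartRepr S p z)) =ᶠ[𝓝 (extChartAt (𝓡 n).tangent p p)]
      fun z => modelC n z := by
    filter_upwards [hslit, chartRepr_tangentEndo_eventuallyEq S p,
      chartRepr_liouville_eventuallyEq p] with z hz hz' hz''
    rw [← hz', ← hz'', chartRepr, chartRepr, hSC _ hz]
  have h3 := h1.fderiv_eq (𝕜 := ℝ)
  have h4 := h2.fderiv_eq (𝕜 := ℝ)
  have h5 : fderiv ℝ (fun z => modelJ n (chartRepr V p z)) (extChartAt (𝓡 n).tangent p p) =
      (modelJ n).comp (fderiv ℝ (chartRepr V p) (extChartAt (𝓡 n).tangent p p)) :=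
    ((modelJ n).hasFDerivAt.comp _ (hV.differentiableAt_chartRepr hp).hasFDerivAt).fderiv
  have h6 : fderiv ℝ (fun z => modelJ n (chartRepr S p z)) (extChartAt (𝓡 n).tangent p p) =
      (modelJ n).comp (fderiv ℝ (chartRepr S p) (extChartAt (𝓡 n).tangent p p)) :=
    ((modelJ n).hasFDerivAt.comp _ (hS.differentiableAt_chartRepr hp).hasFDerivAt).fderiv
  rw [h5] at h3
  rw [h6, (modelC n).hasFDerivAt.fderiv] at h4
  have h7 := congrArg (fun f => f (chartRepr S p (extChartAt (𝓡 n).tangent p p))) h3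
  have h8 := congrArg (fun f => f (chartRepr V p (extChartAt (𝓡 n).tangent p p))) h4
  have h9 := congrArg Prod.snd h1.eq_of_nhds
  simp only [ContinuousLinearMap.comp_apply, modelJ_apply, modelC_apply, fderiv_fun_const] at h7 h8 h9
  rw [tangentEndo_self, lie_apply, ← chartRepr_self V p]
  simp only [VectorField.lieBracket]
  refine Prod.ext ?_ ?_
  · exact h9.symm
  · have h10 := congrArg Prod.snd h7
    have h11 := congrArg Prod.snd h8
    simp only [Prod.fst_sub] at h10 h11 ⊢
    rw [h11, h10]
    simp

lemma contMDiffAt_of_chartD {X : VField n M} {p : TM}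
    (h : ContMDiffAt (𝓡 n).tangent 𝓘(ℝ, 𝔼 × 𝔼) ∞ (fun q => chartD p q (X q)) p) :
    ContMDiffAt (𝓡 n).tangent (𝓡 n).tangent.tangent ∞
      (fun p => (⟨p, X p⟩ : TangentBundle (𝓡 n).tangent (TangentBundle (𝓡 n) M))) p := by
  refine (Bundle.contMDiffAt_section _).2 (h.congr_of_eventuallyEq ?_)
  filter_upwards [(chartAt (ModelProd 𝔼 𝔼) p).open_source.mem_nhds (mem_chart_source _ p)] with q hq
  have h2 := congrArg (fun f => f (X q))
    (TangentBundle.continuousLinearMapAt_trivializationAt (I := (𝓡 n).tangent) hq)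
  refine Eq.trans ?_ h2
  rw [Trivialization.continuousLinearMapAt_apply, Trivialization.linearMapAt_apply, if_pos]
  exact hq

lemma SmoothField.contMDiffAt_chartD {X : VField n M} (hX : SmoothField X) {p : TM}
    (hp : p ∈ slit n M) :
    ContMDiffAt (𝓡 n).tangent 𝓘(ℝ, 𝔼 × 𝔼) ∞ (fun q => chartD p q (X q)) p := by
  refine ((Bundle.contMDiffAt_section _).1 (hX.contMDiffAt hp)).congr_of_eventuallyEq ?_
  filter_upwards [(chartAt (ModelProd 𝔼 𝔼) p).open_source.mem_nhds (mem_chart_source _ p)] with q hq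
  have h2 := congrArg (fun f => f (X q))
    (TangentBundle.continuousLinearMapAt_trivializationAt (I := (𝓡 n).tangent) hq)
  refine Eq.trans h2.symm ?_
  rw [Trivialization.continuousLinearMapAt_apply, Trivialization.linearMapAt_apply, if_pos]
  exact hq

lemma smoothField_tangentEndo {X : VField n M} (hX : SmoothField X) :
    SmoothField (tangentEndo X) := fun p hp => by
  refine (contMDiffAt_of_chartD ?_).contMDiffWithinAt
  have h1 : ContMDiffAt (𝓡 n).tangent 𝓘(ℝ, 𝔼 × 𝔼) ∞ (fun q => modelJ n (chartD p q (X q))) p :=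
    (modelJ n).contMDiff.contMDiffAt.comp p (hX.contMDiffAt_chartD hp)
  refine h1.congr_of_eventuallyEq ?_
  filter_upwards [(chartAt (ModelProd 𝔼 𝔼) p).open_source.mem_nhds (mem_chart_source _ p)] with q hq
  exact chartD_tangentEndo (by simpa using hq) X

lemma smoothField_liouville : SmoothField (liouville (n := n) (M := M)) := fun p hp => by
  refine (contMDiffAt_of_chartD ?_).contMDiffWithinAt
  have h1 : ContMDiffAt (𝓡 n).tangent 𝓘(ℝ, 𝔼 × 𝔼) ∞
      (fun q => modelC n (extChartAt (𝓡 n).tangent p q)) p :=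
    (modelC n).contMDiff.contMDiffAt.comp p contMDiffAt_extChartAt
  refine h1.congr_of_eventuallyEq ?_
  filter_upwards [(chartAt (ModelProd 𝔼 𝔼) p).open_source.mem_nhds (mem_chart_source _ p)] with q hq
  exact chartD_liouville (by simpa using hq)

end Charts

end SprayGeometry

end

noncomputable section

namespace SprayGeometry

/-! ### The Lie–Rinehart algebra of the slit tangent bundle -/

section SlitBundle

open Bundle Filter
open scoped Topology

variable {n : ℕ} {M : Type*} [TopologicalSpace M] [ChartedSpace (EuclideanSpace ℝ (Fin n)) M]
  [IsManifold (𝓡 n) ∞ M]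

local notation "𝔼" => EuclideanSpace ℝ (Fin n)
local notation "TM" => TangentBundle (𝓡 n) M

lemma slit_mem_nhds {p : TM} (hp : p ∈ slit n M) : ∀ᶠ q in 𝓝 p, q ∈ slit n M :=
  isOpen_slit.mem_nhds hp

lemma SmoothFun.congr {f g : TM → ℝ} (hf : SmoothFun f) (h : ∀ p ∈ slit n M, g p = f p) :
    SmoothFun g :=
  ContMDiffOn.congr hf h

lemma SmoothFun.contMDiffAt {f : TM → ℝ} (hf : SmoothFun f) {p : TM} (hp : p ∈ slit n M) :
    ContMDiffAt (𝓡 n).tangent 𝓘(ℝ, ℝ) ∞ f p :=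
  ContMDiffOn.contMDiffAt hf (isOpen_slit.mem_nhds hp)

lemma SmoothFun.mdifferentiableAt {f : TM → ℝ} (hf : SmoothFun f) {p : TM} (hp : p ∈ slit n M) :
    MDifferentiableAt (𝓡 n).tangent 𝓘(ℝ, ℝ) f p :=
  (hf.contMDiffAt hp).mdifferentiableAt (by simp)

lemma SmoothFun.add {f g : TM → ℝ} (hf : SmoothFun f) (hg : SmoothFun g) : SmoothFun (f + g) :=
  ContMDiffOn.add hf hg

lemma SmoothFun.neg {f : TM → ℝ} (hf : SmoothFun f) : SmoothFun (-f) :=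
  ContMDiffOn.neg hf

lemma SmoothFun.mul {f g : TM → ℝ} (hf : SmoothFun f) (hg : SmoothFun g) : SmoothFun (f * g) :=
  ContMDiffOn.mul hf hg

lemma SmoothFun.const (c : ℝ) : SmoothFun (fun _ : TM => c) := contMDiffOn_const

lemma SmoothField.congr {X Y : VField n M} (hX : SmoothField X) (h : ∀ p ∈ slit n M, Y p = X p) :
    SmoothField Y :=
  ContMDiffOn.congr hX fun p hp => by rw [h p hp]

lemma SmoothField.mdifferentiableAt {X : VField n M} (hX : SmoothField X) {p : TM}
    (hp : p ∈ slit n M) :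
    MDifferentiableAt (𝓡 n).tangent (𝓡 n).tangent.tangent
      (fun p => (⟨p, X p⟩ : TangentBundle (𝓡 n).tangent (TangentBundle (𝓡 n) M))) p :=
  (hX.contMDiffAt hp).mdifferentiableAt (by simp)

lemma SmoothField.of_chartD {X : VField n M}
    (h : ∀ p ∈ slit n M,
      ContMDiffAt (𝓡 n).tangent 𝓘(ℝ, 𝔼 × 𝔼) ∞ (fun q => chartD p q (X q)) p) : SmoothField X :=
  fun p hp => (contMDiffAt_of_chartD (h p hp)).contMDiffWithinAt

lemma SmoothField.add {X Y : VField n M} (hX : SmoothField X) (hY : SmoothField Y) :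
    SmoothField (X + Y) :=
  .of_chartD fun p hp => by
    simpa only [Pi.add_apply, map_add] using!
      (hX.contMDiffAt_chartD hp).add (hY.contMDiffAt_chartD hp)

lemma SmoothField.smul {f : TM → ℝ} {X : VField n M} (hf : SmoothFun f) (hX : SmoothField X) :
    SmoothField (fun p => f p • X p) :=
  .of_chartD fun p hp => by
    simpa only [map_smul] using! (hf.contMDiffAt hp).smul (hX.contMDiffAt_chartD hp)

lemma SmoothField.const_smul (c : ℝ) {X : VField n M} (hX : SmoothField X) :
    SmoothField (c • X) :=
  SmoothField.smul (SmoothFun.const c) hX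

lemma SmoothField.neg {X : VField n M} (hX : SmoothField X) : SmoothField (-X) :=
  (hX.const_smul (-1)).congr fun p _ => by simp

lemma SmoothField.sub {X Y : VField n M} (hX : SmoothField X) (hY : SmoothField Y) :
    SmoothField (X - Y) := by
  rw [sub_eq_add_neg]; exact hX.add hY.neg

lemma SmoothField.zero : SmoothField (0 : VField n M) :=
  (smoothField_liouville.const_smul 0).congr fun p _ => by simp

instance isManifold_minSmoothness_three :
    IsManifold (𝓡 n).tangent (minSmoothness ℝ 3) TM := by
  rw [minSmoothness_of_isRCLikeNormedField]
  exact IsManifold.of_le (n := ∞) (WithTop.coe_le_coe.2 le_top)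

lemma SmoothField.lie {X Y : VField n M} (hX : SmoothField X) (hY : SmoothField Y) :
    SmoothField (lie X Y) := fun p hp => by
  have : IsManifold (𝓡 n).tangent (((⊤ : ℕ∞) : WithTop ℕ∞) + 1) TM := by
    have : ((⊤ : ℕ∞) : WithTop ℕ∞) + 1 = ((⊤ : ℕ∞) : WithTop ℕ∞) := rfl
    rw [this]; infer_instance
  refine ContMDiffAt.contMDiffWithinAt (ContMDiffAt.mlieBracket_vectorField (m := ⊤) (n := ⊤)
    (hX.contMDiffAt hp) (hY.contMDiffAt hp) ?_)
  rw [minSmoothness_of_isRCLikeNormedField]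
  rfl

lemma SmoothFun.dirDeriv {X : VField n M} {f : TM → ℝ} (hX : SmoothField X) (hf : SmoothFun f) :
    SmoothFun (dirDeriv X f) := by
  have h1 := ContMDiffOn.contMDiffOn_tangentMapWithin (m := ∞) hf (by rfl)
    isOpen_slit.uniqueMDiffOn
  have h2 := h1.comp hX fun p hp => hp
  intro p hp
  have h3 := (Bundle.contMDiffAt_totalSpace.1 (h2.contMDiffAt (isOpen_slit.mem_nhds hp))).2
  refine (h3.congr_of_eventuallyEq ?_).contMDiffWithinAt
  filter_upwards [slit_mem_nhds hp] with q hq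
  simp only [Function.comp, tangentMapWithin]
  rw [trivializationAt_model_space_apply, mfderivWithin_of_isOpen isOpen_slit hq]
  rfl

/-- The bracket is local and `T₀M` is open, so values on the zero section are irrelevant and
extension by zero is harmless. -/
lemma lie_congr {X X' Y Y' : VField n M} (hX : ∀ p ∈ slit n M, X p = X' p)
    (hY : ∀ p ∈ slit n M, Y p = Y' p) {p : TM} (hp : p ∈ slit n M) : lie X Y p = lie X' Y' p := by
  apply Filter.EventuallyEq.mlieBracket_vectorField_eq
  · filter_upwards [slit_mem_nhds hp] with q hq using hX q hq
  · filter_upwards [slit_mem_nhds hp] with q hq using hY q hq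

lemma dirDeriv_congr {X X' : VField n M} {f f' : TM → ℝ} (hX : ∀ p ∈ slit n M, X p = X' p)
    (hf : ∀ p ∈ slit n M, f p = f' p) {p : TM} (hp : p ∈ slit n M) :
    dirDeriv X f p = dirDeriv X' f' p := by
  have : f =ᶠ[𝓝 p] f' := by
    filter_upwards [slit_mem_nhds hp] with q hq using hf q hq
  simp only [dirDeriv, mvfderiv, hX p hp]
  have h1 := this.mfderiv_eq (I := (𝓡 n).tangent) (I' := 𝓘(ℝ, ℝ))
  exact congrArg (fun g : 𝔼 × 𝔼 →L[ℝ] ℝ => g (X' p)) h1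

lemma lie_self_apply (X : VField n M) (p : TM) : lie X X p = 0 := by
  simp [lie]

lemma lie_add_apply {X Y Z : VField n M} (hY : SmoothField Y) (hZ : SmoothField Z)
    {p : TM} (hp : p ∈ slit n M) : lie X (Y + Z) p = lie X Y p + lie X Z p :=
  VectorField.mlieBracket_add_right (hY.mdifferentiableAt hp) (hZ.mdifferentiableAt hp)

lemma add_lie_apply {X Y Z : VField n M} (hX : SmoothField X) (hY : SmoothField Y)
    {p : TM} (hp : p ∈ slit n M) : lie (X + Y) Z p = lie X Z p + lie Y Z p :=
  VectorField.mlieBracket_add_left (hX.mdifferentiableAt hp) (hY.mdifferentiableAt hp)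

lemma lie_smul_apply {X Y : VField n M} {f : TM → ℝ} (hf : SmoothFun f) (hY : SmoothField Y)
    {p : TM} (hp : p ∈ slit n M) :
    lie X (fun q => f q • Y q) p = dirDeriv X f p • Y p + f p • lie X Y p :=
  VectorField.mlieBracket_smul_right (hf.mdifferentiableAt hp) (hY.mdifferentiableAt hp)

lemma lie_leibniz_apply {X Y Z : VField n M} (hX : SmoothField X) (hY : SmoothField Y)
    (hZ : SmoothField Z) {p : TM} (hp : p ∈ slit n M) :
    lie X (lie Y Z) p = lie (lie X Y) Z p + lie Y (lie X Z) p := by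
  have h : minSmoothness ℝ 2 ≤ (∞ : WithTop ℕ∞) := by
    rw [minSmoothness_of_isRCLikeNormedField]
    exact WithTop.coe_le_coe.2 le_top
  exact VectorField.leibniz_identity_mlieBracket_apply ((hX.contMDiffAt hp).of_le h)
    ((hY.contMDiffAt hp).of_le h) ((hZ.contMDiffAt hp).of_le h)

/-- Expand the Jacobi identity for `X`, `Y` and `f C`: the claim is the coefficient of `C`, which
vanishes nowhere on `T₀M`. -/
lemma dirDeriv_lie {X Y : VField n M} {f : TM → ℝ} (hX : SmoothField X) (hY : SmoothField Y)
    (hf : SmoothFun f) {p : TM} (hp : p ∈ slit n M) :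
    dirDeriv (lie X Y) f p = dirDeriv X (dirDeriv Y f) p - dirDeriv Y (dirDeriv X f) p := by
  have hC : SmoothField (liouville (n := n) (M := M)) := smoothField_liouville
  have expand : ∀ {X Y : VField n M}, SmoothField X → SmoothField Y →
      lie X (lie Y (fun q => f q • liouville q)) p =
        (dirDeriv X (dirDeriv Y f) p • liouville p + dirDeriv Y f p • lie X liouville p) +
        (dirDeriv X f p • lie Y liouville p + f p • lie X (lie Y liouville) p) := by
    intro X Y hX hY
    rw [lie_congr (X' := X) (fun _ _ => rfl)
      (Y' := (fun q => dirDeriv Y f q • liouville q) + fun q => f q • lie Y liouville q)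
      (fun q hq => lie_smul_apply hf hC hq) hp,
      lie_add_apply (SmoothField.smul (hf.dirDeriv hY) hC) (SmoothField.smul hf (hY.lie hC)) hp,
      lie_smul_apply (hf.dirDeriv hY) hC hp, lie_smul_apply hf (hY.lie hC) hp]
  have h1 := lie_leibniz_apply hX hY (SmoothField.smul hf hC) hp
  rw [expand hX hY, expand hY hX, lie_smul_apply hf hC hp, lie_leibniz_apply hX hY hC hp] at h1
  have h2 : (dirDeriv (SprayGeometry.lie X Y) f p - (dirDeriv X (dirDeriv Y f) p
      - dirDeriv Y (dirDeriv X f) p)) • liouville p = 0 := by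
    linear_combination (norm := module) -h1
  have h3 := (smul_eq_zero.1 h2).resolve_right (liouville_ne_zero hp)
  linear_combination h3

end SlitBundle

end SprayGeometry

end

noncomputable section

namespace SprayGeometry

/-! ### Smooth functions and vector fields on `T₀M` as a Lie–Rinehart ring -/

section SlitBundle

open Bundle Filter
open scoped Topology Classical

variable {n : ℕ} {M : Type*} [TopologicalSpace M] [ChartedSpace (EuclideanSpace ℝ (Fin n)) M]
  [IsManifold (𝓡 n) ∞ M]

local notation "TM" => TangentBundle (𝓡 n) M

/-- The extension by zero of a function on the slit tangent bundle. -/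
def extendFun (f : slit n M → ℝ) : TM → ℝ := fun p => if h : p ∈ slit n M then f ⟨p, h⟩ else 0

/-- The extension by zero of a vector field on the slit tangent bundle. -/
def extendField (X : (p : slit n M) → TangentSpace (𝓡 n).tangent p.1) : VField n M :=
  fun p => if h : p ∈ slit n M then X ⟨p, h⟩ else 0

@[simp] lemma extendFun_apply (f : slit n M → ℝ) (p : slit n M) : extendFun f p = f p :=
  dif_pos p.2

@[simp] lemma extendField_apply (X : (p : slit n M) → TangentSpace (𝓡 n).tangent p.1)
    (p : slit n M) : extendField X p = X p :=
  dif_pos p.2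

variable (n M) in
/-- The ring `C^∞(T₀M)`. -/
def slitFunSubring : Subring (slit n M → ℝ) where
  carrier := {f | SmoothFun (extendFun f)}
  mul_mem' {f g} hf hg := (SmoothFun.mul hf hg).congr fun p hp => by simp [extendFun, hp]
  one_mem' := (SmoothFun.const 1).congr fun p hp => by simp [extendFun, hp]
  add_mem' {f g} hf hg := (SmoothFun.add hf hg).congr fun p hp => by simp [extendFun, hp]
  zero_mem' := (SmoothFun.const 0).congr fun p hp => by simp [extendFun, hp]
  neg_mem' {f} hf := (SmoothFun.neg hf).congr fun p hp => by simp [extendFun, hp]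

variable (n M) in
/-- The ring `C^∞(T₀M)`, as a type. -/
def SlitFun : Type _ := slitFunSubring n M

instance : CommRing (SlitFun n M) := inferInstanceAs (CommRing (slitFunSubring n M))

variable (n M) in
/-- The additive group `𝔛(T₀M)`. -/
def slitFieldSubgroup : AddSubgroup ((p : slit n M) → TangentSpace (𝓡 n).tangent p.1) where
  carrier := {X | SmoothField (extendField X)}
  add_mem' {f g} hf hg := (SmoothField.add hf hg).congr fun p hp => by simp [extendField, hp]
  zero_mem' := SmoothField.zero.congr fun p hp => by simp [extendField, hp]
  neg_mem' {f} hf := (SmoothField.neg hf).congr fun p hp => by simp [extendField, hp]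

variable (n M) in
/-- The Lie algebra `𝔛(T₀M)`. -/
def SlitField : Type _ := slitFieldSubgroup n M

instance : AddCommGroup (SlitField n M) := inferInstanceAs (AddCommGroup (slitFieldSubgroup n M))

/-- The restriction to `T₀M` of a smooth function. -/
def restrictFun (f : TM → ℝ) (hf : SmoothFun f) : SlitFun n M :=
  ⟨fun p => f p, hf.congr fun p hp => by simp [extendFun, hp]⟩

/-- The restriction to `T₀M` of a smooth vector field. -/
def restrictField (X : VField n M) (hX : SmoothField X) : SlitField n M :=
  ⟨fun p => X p, hX.congr fun p hp => by simp [extendField, hp]⟩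

/-- The extension by zero of a function in `C^∞(T₀M)`. -/
def SlitFun.toFun (f : SlitFun n M) : TM → ℝ := extendFun f.1

/-- The extension by zero of a vector field in `𝔛(T₀M)`. -/
def SlitField.toField (X : SlitField n M) : VField n M := extendField X.1

lemma SlitFun.smooth (f : SlitFun n M) : SmoothFun f.toFun := f.2

lemma SlitField.smooth (X : SlitField n M) : SmoothField X.toField := X.2

lemma SlitFun.ext_slit {f g : SlitFun n M} (h : ∀ p ∈ slit n M, f.toFun p = g.toFun p) : f = g :=
  Subtype.ext (funext fun p => by simpa [SlitFun.toFun] using h p p.2)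

lemma SlitField.ext_slit {X Y : SlitField n M} (h : ∀ p ∈ slit n M, X.toField p = Y.toField p) :
    X = Y :=
  Subtype.ext (funext fun p => by simpa [SlitField.toField] using h p p.2)

lemma restrictFun_toFun {f : TM → ℝ} (hf : SmoothFun f) {p : TM} (hp : p ∈ slit n M) :
    (restrictFun f hf).toFun p = f p := dif_pos hp

lemma restrictField_toField {X : VField n M} (hX : SmoothField X) {p : TM} (hp : p ∈ slit n M) :
    (restrictField X hX).toField p = X p := dif_pos hp

lemma SlitFun.toFun_add (f g : SlitFun n M) (p : TM) :
    (f + g).toFun p = f.toFun p + g.toFun p := by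
  by_cases hp : p ∈ slit n M
  · simp only [SlitFun.toFun, extendFun, hp, dif_pos]; rfl
  · simp [SlitFun.toFun, extendFun, hp]

lemma SlitFun.toFun_sub (f g : SlitFun n M) (p : TM) :
    (f - g).toFun p = f.toFun p - g.toFun p := by
  by_cases hp : p ∈ slit n M
  · simp only [SlitFun.toFun, extendFun, hp, dif_pos]; rfl
  · simp [SlitFun.toFun, extendFun, hp]

lemma SlitFun.toFun_mul (f g : SlitFun n M) (p : TM) :
    (f * g).toFun p = f.toFun p * g.toFun p := by
  by_cases hp : p ∈ slit n M
  · simp only [SlitFun.toFun, extendFun, hp, dif_pos]; rfl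
  · simp [SlitFun.toFun, extendFun, hp]

lemma SlitFun.toFun_zero (p : TM) : (0 : SlitFun n M).toFun p = 0 := by
  by_cases hp : p ∈ slit n M
  · simp only [SlitFun.toFun, extendFun, hp, dif_pos]; rfl
  · simp [SlitFun.toFun, extendFun, hp]

lemma SlitFun.toFun_one {p : TM} (hp : p ∈ slit n M) : (1 : SlitFun n M).toFun p = 1 := by
  simp only [SlitFun.toFun, extendFun, hp, dif_pos]; rfl

lemma SlitFun.toFun_two {p : TM} (hp : p ∈ slit n M) : (2 : SlitFun n M).toFun p = 2 := by
  rw [← one_add_one_eq_two, SlitFun.toFun_add, SlitFun.toFun_one hp]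
  norm_num

lemma SlitField.toField_add (X Y : SlitField n M) (p : TM) :
    (X + Y).toField p = X.toField p + Y.toField p := by
  by_cases hp : p ∈ slit n M
  · simp only [SlitField.toField, extendField, hp, dif_pos]; rfl
  · simp [SlitField.toField, extendField, hp]

lemma SlitField.toField_sub (X Y : SlitField n M) (p : TM) :
    (X - Y).toField p = X.toField p - Y.toField p := by
  by_cases hp : p ∈ slit n M
  · simp only [SlitField.toField, extendField, hp, dif_pos]; rfl
  · simp [SlitField.toField, extendField, hp]

lemma SlitField.toField_zero (p : TM) : (0 : SlitField n M).toField p = 0 := by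
  by_cases hp : p ∈ slit n M
  · simp only [SlitField.toField, extendField, hp, dif_pos]; rfl
  · simp [SlitField.toField, extendField, hp]

instance : SMul (SlitFun n M) (SlitField n M) where
  smul f X := restrictField (fun p => f.toFun p • X.toField p) (SmoothField.smul f.smooth X.smooth)

lemma SlitField.toField_smul (f : SlitFun n M) (X : SlitField n M) {p : TM} (hp : p ∈ slit n M) :
    (f • X).toField p = f.toFun p • X.toField p :=
  restrictField_toField (SmoothField.smul f.smooth X.smooth) hp

instance : Module (SlitFun n M) (SlitField n M) where
  one_smul X := SlitField.ext_slit fun p hp => by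
    rw [SlitField.toField_smul _ _ hp, SlitFun.toFun_one hp, one_smul]
  mul_smul f g X := SlitField.ext_slit fun p hp => by
    simp only [SlitField.toField_smul _ _ hp, SlitFun.toFun_mul, mul_smul]
  smul_zero f := SlitField.ext_slit fun p hp => by
    simp only [SlitField.toField_smul _ _ hp, SlitField.toField_zero, smul_zero]
  smul_add f X Y := SlitField.ext_slit fun p hp => by
    simp only [SlitField.toField_smul _ _ hp, SlitField.toField_add, smul_add]
  add_smul f g X := SlitField.ext_slit fun p hp => by
    simp only [SlitField.toField_smul _ _ hp, SlitField.toField_add, SlitFun.toFun_add, add_smul]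
  zero_smul X := SlitField.ext_slit fun p hp => by
    simp only [SlitField.toField_smul _ _ hp, SlitField.toField_zero, SlitFun.toFun_zero, zero_smul]

/-- The Lie bracket of vector fields on `T₀M`. -/
def slitLie (X Y : SlitField n M) : SlitField n M :=
  restrictField (lie X.toField Y.toField) (X.smooth.lie Y.smooth)

/-- The derivative of a function along a vector field on `T₀M`. -/
def slitDeriv (X : SlitField n M) (f : SlitFun n M) : SlitFun n M :=
  restrictFun (dirDeriv X.toField f.toFun) (f.smooth.dirDeriv X.smooth)

lemma toField_slitLie (X Y : SlitField n M) {p : TM} (hp : p ∈ slit n M) :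
    (slitLie X Y).toField p = lie X.toField Y.toField p :=
  restrictField_toField (X.smooth.lie Y.smooth) hp

lemma toFun_slitDeriv (X : SlitField n M) (f : SlitFun n M) {p : TM} (hp : p ∈ slit n M) :
    (slitDeriv X f).toFun p = dirDeriv X.toField f.toFun p :=
  restrictFun_toFun (f.smooth.dirDeriv X.smooth) hp

instance : LieRing (SlitField n M) where
  bracket := slitLie
  add_lie X Y Z := SlitField.ext_slit fun p hp => by
    rw [SlitField.toField_add, toField_slitLie _ _ hp, toField_slitLie _ _ hp,
      toField_slitLie _ _ hp, ← add_lie_apply X.smooth Y.smooth hp]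
    exact lie_congr (fun q _ => SlitField.toField_add X Y q) (fun _ _ => rfl) hp
  lie_add X Y Z := SlitField.ext_slit fun p hp => by
    rw [SlitField.toField_add, toField_slitLie _ _ hp, toField_slitLie _ _ hp,
      toField_slitLie _ _ hp, ← lie_add_apply Y.smooth Z.smooth hp]
    exact lie_congr (fun _ _ => rfl) (fun q _ => SlitField.toField_add Y Z q) hp
  lie_self X := SlitField.ext_slit fun p hp => by
    rw [toField_slitLie _ _ hp, lie_self_apply, SlitField.toField_zero]
  leibniz_lie X Y Z := SlitField.ext_slit fun p hp => by
    rw [SlitField.toField_add, toField_slitLie _ _ hp, toField_slitLie _ _ hp,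
      toField_slitLie _ _ hp,
      lie_congr (fun _ _ => rfl) (fun q hq => toField_slitLie Y Z hq) hp,
      lie_congr (fun q hq => toField_slitLie X Y hq) (fun _ _ => rfl) hp,
      lie_congr (fun _ _ => rfl) (fun q hq => toField_slitLie X Z hq) hp]
    exact lie_leibniz_apply X.smooth Y.smooth Z.smooth hp

lemma SlitField.toField_lie (X Y : SlitField n M) {p : TM} (hp : p ∈ slit n M) :
    ⁅X, Y⁆.toField p = lie X.toField Y.toField p :=
  toField_slitLie X Y hp

instance : LieRingModule (SlitField n M) (SlitFun n M) where
  bracket := slitDeriv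
  add_lie X Y f := SlitFun.ext_slit fun p hp => by
    rw [SlitFun.toFun_add, toFun_slitDeriv _ _ hp, toFun_slitDeriv _ _ hp,
      toFun_slitDeriv _ _ hp]
    simp only [dirDeriv, SlitField.toField_add, map_add]
  lie_add X f g := SlitFun.ext_slit fun p hp => by
    rw [SlitFun.toFun_add, toFun_slitDeriv _ _ hp, toFun_slitDeriv _ _ hp,
      toFun_slitDeriv _ _ hp,
      dirDeriv_congr (f' := f.toFun + g.toFun) (fun _ _ => rfl)
        (fun q _ => SlitFun.toFun_add f g q) hp]
    simp only [dirDeriv]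
    rw [mvfderiv_add (f.smooth.mdifferentiableAt hp) (g.smooth.mdifferentiableAt hp)]
    rfl
  leibniz_lie X Y f := SlitFun.ext_slit fun p hp => by
    rw [SlitFun.toFun_add, toFun_slitDeriv _ _ hp, toFun_slitDeriv _ _ hp,
      toFun_slitDeriv _ _ hp,
      dirDeriv_congr (fun _ _ => rfl) (fun q hq => toFun_slitDeriv Y f hq) hp,
      dirDeriv_congr (fun q hq => SlitField.toField_lie X Y hq) (fun _ _ => rfl) hp,
      dirDeriv_congr (fun _ _ => rfl) (fun q hq => toFun_slitDeriv X f hq) hp,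
      dirDeriv_lie X.smooth Y.smooth f.smooth hp]
    ring

lemma SlitFun.toFun_lie (X : SlitField n M) (f : SlitFun n M) {p : TM} (hp : p ∈ slit n M) :
    ⁅X, f⁆.toFun p = dirDeriv X.toField f.toFun p :=
  toFun_slitDeriv X f hp

instance : LieRinehartRing (SlitFun n M) (SlitField n M) where
  lie_smul_eq_mul' f g X := SlitFun.ext_slit fun p hp => by
    rw [SlitFun.toFun_mul, SlitFun.toFun_lie _ _ hp, SlitFun.toFun_lie _ _ hp]
    simp only [dirDeriv, SlitField.toField_smul _ _ hp, map_smul, smul_eq_mul]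
  leibniz_mul_right' X f g := SlitFun.ext_slit fun p hp => by
    rw [SlitFun.toFun_add, smul_eq_mul, SlitFun.toFun_mul, SlitFun.toFun_mul,
      SlitFun.toFun_lie _ _ hp, SlitFun.toFun_lie _ _ hp, SlitFun.toFun_lie _ _ hp,
      dirDeriv_congr (f' := f.toFun * g.toFun) (fun _ _ => rfl)
        (fun q _ => SlitFun.toFun_mul f g q) hp]
    simp only [dirDeriv]
    rw [mvfderiv_mul (f.smooth.mdifferentiableAt hp) (g.smooth.mdifferentiableAt hp)]
    simp only [add_apply, smul_apply, smul_eq_mul]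
    ring
  leibniz_smul_right' X Y f := SlitField.ext_slit fun p hp => by
    rw [SlitField.toField_add, SlitField.toField_smul _ _ hp, SlitField.toField_smul _ _ hp,
      SlitField.toField_lie _ _ hp, SlitField.toField_lie _ _ hp, SlitFun.toFun_lie _ _ hp,
      lie_congr (fun _ _ => rfl) (fun q hq => SlitField.toField_smul f Y hq) hp,
      lie_smul_apply f.smooth Y.smooth hp, add_comm]

end SlitBundle

end SprayGeometry

end

noncomputable section

namespace SprayGeometry

/-! ### Dictionary between objects on `TM` and the algebra of `T₀M` -/

section SlitBundle

open Bundle Filter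
open scoped Topology

variable {n : ℕ} {M : Type*} [TopologicalSpace M] [ChartedSpace (EuclideanSpace ℝ (Fin n)) M]
  [IsManifold (𝓡 n) ∞ M]

local notation "TM" => TangentBundle (𝓡 n) M

/-- The tangent endomorphism of `T₀M`. -/
def slitJ : SlitField n M →ₗ[SlitFun n M] SlitField n M where
  toFun X := restrictField (tangentEndo X.toField) (smoothField_tangentEndo X.smooth)
  map_add' X Y := SlitField.ext_slit fun p hp => by
    rw [SlitField.toField_add]
    simp only [restrictField_toField _ hp, tangentEndo_self, SlitField.toField_add]
    exact Prod.ext (add_zero (0 : EuclideanSpace ℝ (Fin n))).symm rfl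
  map_smul' f X := SlitField.ext_slit fun p hp => by
    rw [RingHom.id_apply, SlitField.toField_smul _ _ hp]
    simp only [restrictField_toField _ hp, tangentEndo_self, SlitField.toField_smul _ _ hp]
    exact Prod.ext (smul_zero (A := EuclideanSpace ℝ (Fin n)) (f.toFun p)).symm rfl

/-- The Liouville vector field of `T₀M`. -/
def slitC : SlitField n M := restrictField liouville smoothField_liouville

/-- The constant function `1 / 2` on `T₀M`. -/
def slitHalf : SlitFun n M := restrictFun (fun _ => 1 / 2) (SmoothFun.const _)

lemma two_mul_slitHalf : 2 * (slitHalf : SlitFun n M) = 1 := SlitFun.ext_slit fun p hp => by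
  rw [SlitFun.toFun_mul, SlitFun.toFun_two hp, SlitFun.toFun_one hp, slitHalf,
    restrictFun_toFun _ hp]
  norm_num

/-- The horizontal projector of a vector field on `T₀M`. -/
def slitH (S : SlitField n M) : SlitField n M →ₗ[SlitFun n M] SlitField n M :=
  horizEndo slitHalf slitJ S

/-- `X` and `x` agree on `T₀M`. -/
def RepField (X : VField n M) (x : SlitField n M) : Prop := ∀ p ∈ slit n M, X p = x.toField p

/-- `f` and `a` agree on `T₀M`. -/
def RepFun (f : TM → ℝ) (a : SlitFun n M) : Prop := ∀ p ∈ slit n M, f p = a.toFun p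

lemma repField_restrict {X : VField n M} (hX : SmoothField X) : RepField X (restrictField X hX) :=
  fun _ hp => (restrictField_toField hX hp).symm

lemma repFun_restrict {f : TM → ℝ} (hf : SmoothFun f) : RepFun f (restrictFun f hf) :=
  fun _ hp => (restrictFun_toFun hf hp).symm

lemma repField_toField (x : SlitField n M) : RepField x.toField x := fun _ _ => rfl

lemma repField_liouville : RepField (liouville (n := n) (M := M)) slitC :=
  repField_restrict smoothField_liouville

section Rep

variable {X Y : VField n M} {x y : SlitField n M} {f g : TangentBundle (𝓡 n) M → ℝ} {a b : SlitFun n M}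

lemma RepField.add (hX : RepField X x) (hY : RepField Y y) : RepField (X + Y) (x + y) :=
  fun p hp => by rw [SlitField.toField_add, Pi.add_apply, hX p hp, hY p hp]

lemma RepField.sub (hX : RepField X x) (hY : RepField Y y) : RepField (X - Y) (x - y) :=
  fun p hp => by rw [SlitField.toField_sub, Pi.sub_apply, hX p hp, hY p hp]

lemma RepField.smul (hf : RepFun f a) (hX : RepField X x) :
    RepField (fun p => f p • X p) (a • x) :=
  fun p hp => by simp only [SlitField.toField_smul _ _ hp, hX p hp, hf p hp]

lemma RepField.half_smul (hX : RepField X x) :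
    RepField ((1 / 2 : ℝ) • X) ((slitHalf : SlitFun n M) • x) :=
  RepField.smul (repFun_restrict (SmoothFun.const (1 / 2))) hX

lemma RepField.lie (hX : RepField X x) (hY : RepField Y y) : RepField (lie X Y) ⁅x, y⁆ :=
  fun _ hp => by rw [SlitField.toField_lie _ _ hp, lie_congr hX hY hp]

lemma RepField.tangentEndo (hX : RepField X x) : RepField (tangentEndo X) (slitJ x) :=
  fun p hp => by
    refine Eq.trans ?_ (restrictField_toField (smoothField_tangentEndo x.smooth) hp).symm
    simp only [SprayGeometry.tangentEndo, hX p hp]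

lemma RepField.horiz {S : VField n M} {s : SlitField n M} (hS : RepField S s)
    (hX : RepField X x) : RepField (horiz S X) (slitH s x) := by
  have h := (hX.sub ((hS.lie hX.tangentEndo).sub (hS.lie hX).tangentEndo)).half_smul
  have e : x - (⁅s, slitJ x⁆ - slitJ ⁅s, x⁆) = x - ⁅s, slitJ x⁆ + slitJ ⁅s, x⁆ := by abel
  rw [e] at h
  exact h

lemma RepField.vert {S : VField n M} {s : SlitField n M} (hS : RepField S s)
    (hX : RepField X x) : RepField (vert S X) (x - slitH s x) := by
  have h := hX.sub (hS.horiz hX)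
  intro p hp
  rw [← h p hp]
  simp only [SprayGeometry.vert, SprayGeometry.horiz, Pi.smul_apply, Pi.add_apply, Pi.sub_apply]
  module

lemma RepField.jacobiEndo {S : VField n M} {s : SlitField n M} (hS : RepField S s)
    (hX : RepField X x) : RepField (jacobiEndo S X)
      ((⁅s, slitH s x⁆ - slitH s ⁅s, x⁆) - slitH s (⁅s, slitH s x⁆ - slitH s ⁅s, x⁆)) :=
  hS.vert ((hS.lie (hS.horiz hX)).sub (hS.horiz (hS.lie hX)))

lemma RepField.curvature {S : VField n M} {s : SlitField n M} (hS : RepField S s)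
    (hX : RepField X x) (hY : RepField Y y) : RepField (curvature S X Y)
      (⁅slitH s x, slitH s y⁆ + slitH s (slitH s ⁅x, y⁆) - slitH s ⁅slitH s x, y⁆
        - slitH s ⁅x, slitH s y⁆) := by
  have hx := hS.horiz hX
  have hy := hS.horiz hY
  have hxy := hS.horiz (hS.horiz (hX.lie hY))
  have hb := hS.horiz ((hx.lie hY).add (hX.lie hy))
  have h := ((((((hx.lie hy).add (hx.lie hy)).add hxy).add hxy).sub hb).sub hb).half_smul
  intro p hp
  exact (h p hp).trans (congrArg (fun z : SlitField n M => z.toField p)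
    (half_curvature two_mul_slitHalf (slitH s) x y))

lemma RepFun.add (hf : RepFun f a) (hg : RepFun g b) : RepFun (f + g) (a + b) :=
  fun p hp => by rw [SlitFun.toFun_add, Pi.add_apply, hf p hp, hg p hp]

lemma RepFun.sub (hf : RepFun f a) (hg : RepFun g b) : RepFun (f - g) (a - b) :=
  fun p hp => by rw [SlitFun.toFun_sub, Pi.sub_apply, hf p hp, hg p hp]

lemma RepFun.mul (hf : RepFun f a) (hg : RepFun g b) : RepFun (f * g) (a * b) :=
  fun p hp => by rw [SlitFun.toFun_mul, Pi.mul_apply, hf p hp, hg p hp]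

lemma RepField.dirDeriv (hX : RepField X x) (hf : RepFun f a) : RepFun (dirDeriv X f) ⁅x, a⁆ :=
  fun _ hp => by rw [SlitFun.toFun_lie _ _ hp, dirDeriv_congr hX hf hp]

end Rep

/-- A smooth 1-form as a linear form on the module of vector fields on `T₀M`. -/
def slitForm (α : OneForm n M) (hα : ∀ X : VField n M, SmoothField X → SmoothFun (ev α X)) :
    SlitField n M →ₗ[SlitFun n M] SlitFun n M where
  toFun X := restrictFun (ev α X.toField) (hα _ X.smooth)
  map_add' X Y := SlitFun.ext_slit fun p hp => by
    rw [SlitFun.toFun_add]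
    simp only [restrictFun_toFun _ hp, ev, SlitField.toField_add, map_add]
  map_smul' f X := SlitFun.ext_slit fun p hp => by
    rw [RingHom.id_apply, smul_eq_mul, SlitFun.toFun_mul]
    simp only [restrictFun_toFun _ hp, ev, SlitField.toField_smul _ _ hp, map_smul, smul_eq_mul]

lemma RepField.ev {α : OneForm n M} (hα : ∀ X : VField n M, SmoothField X → SmoothFun (ev α X))
    {X : VField n M} {x : SlitField n M} (hX : RepField X x) : RepFun (ev α X) (slitForm α hα x) :=
  fun p hp => by
    refine Eq.trans ?_ (restrictFun_toFun (hα _ x.smooth) hp).symm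
    simp only [SprayGeometry.ev, hX p hp]

lemma IsSemiBasic.slitForm_vertical {α : OneForm n M} (hα : IsSemiBasic α) (V : SlitField n M)
    (hV : slitJ V = 0) : slitForm α hα.smooth V = 0 := SlitFun.ext_slit fun p hp => by
  rw [← (repField_toField V).ev hα.smooth p hp, SlitFun.toFun_zero]
  refine hα.vertical p hp _ (dproj_eq_zero_of_tangentEndo ?_)
  rw [(repField_toField V).tangentEndo p hp, hV, SlitField.toField_zero]

/-- The terms `X(α(K Y))` and `Y(α(K X))` occur in both `i_K dα` and `d i_K α` and cancel, leaving
`dForm`. -/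
lemma repFun_dAlong {K : VField n M → VField n M} {k : SlitField n M →ₗ[SlitFun n M] SlitField n M}
    (hK : ∀ {X x}, RepField X x → RepField (K X) (k x)) {α : OneForm n M}
    (hα : ∀ X : VField n M, SmoothField X → SmoothFun (ev α X)) {X Y : VField n M}
    {x y : SlitField n M} (hX : RepField X x) (hY : RepField Y y) :
    RepFun (dAlong K α X Y) (dForm k (slitForm α hα) x y) := by
  have hx := hK hX
  have hy := hK hY
  have h1 := ((hx.dirDeriv (hY.ev hα)).sub (hY.dirDeriv (hx.ev hα))).sub ((hx.lie hY).ev hα)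
  have h2 := ((hX.dirDeriv (hy.ev hα)).sub (hy.dirDeriv (hX.ev hα))).sub ((hX.lie hy).ev hα)
  have h3 := ((hX.dirDeriv (hy.ev hα)).sub (hY.dirDeriv (hx.ev hα))).sub
    ((hK (hX.lie hY)).ev hα)
  intro p hp
  refine ((h1.add h2).sub h3 p hp).trans (congrArg (fun z : SlitFun n M => z.toFun p) ?_)
  simp only [dForm, map_add, map_sub]
  ring

lemma slit_two_cancel (X : SlitField n M) (h : (2 : SlitFun n M) • X = 0) : X = 0 := by
  have := congrArg (fun Y => (slitHalf : SlitFun n M) • Y) h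
  simpa only [smul_smul, mul_comm slitHalf (2 : SlitFun n M), two_mul_slitHalf, one_smul,
    smul_zero] using this

lemma IsSpray.isSprayAlgebra {S : VField n M} (hS : IsSpray S) :
    IsSprayAlgebra slitJ (slitH (restrictField S hS.smooth)) slitC
      (restrictField S hS.smooth) where
  two_cancel := slit_two_cancel
  sq_eq_zero X := SlitField.ext_slit fun p hp => by
    rw [SlitField.toField_zero, ← (repField_toField X).tangentEndo.tangentEndo p hp,
      tangentEndo_self, tangentEndo_self]
    rfl
  nijenhuis X Y := SlitField.ext_slit fun p hp => by
    have hX := repField_toField X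
    have hY := repField_toField Y
    rw [SlitField.toField_add, ← (hX.tangentEndo.lie hY.tangentEndo) p hp,
      ← (hX.tangentEndo.lie hY).tangentEndo p hp, ← (hX.lie hY.tangentEndo).tangentEndo p hp,
      lie_tangentEndo_tangentEndo X.smooth Y.smooth hp]
  lie_liouville X := SlitField.ext_slit fun p hp => by
    have hX := repField_toField X
    have hC := repField_liouville (n := n) (M := M)
    rw [SlitField.toField_sub, ← (hC.lie hX.tangentEndo) p hp,
      ← (hC.lie hX).tangentEndo p hp, ← hX.tangentEndo p hp, lie_liouville_tangentEndo X.smooth hp]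
  semispray := SlitField.ext_slit fun p hp => by
    rw [← (repField_restrict hS.smooth).tangentEndo p hp, ← repField_liouville p hp,
      hS.semispray p hp]
  homogeneous := SlitField.ext_slit fun p hp => by
    rw [← (repField_liouville.lie (repField_restrict hS.smooth)) p hp,
      ← repField_restrict hS.smooth p hp, hS.homogeneous p hp]
  vertical V hV := SlitField.ext_slit fun p hp => by
    have h := repField_toField V
    rw [← (h.lie (repField_restrict hS.smooth)).tangentEndo p hp]
    refine tangentEndo_lie_vertical V.smooth hS.smooth (fun q hq => ?_) hS.semispray hp
    rw [h.tangentEndo q hq, hV, SlitField.toField_zero]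
  two_horiz X := by
    rw [slitH, horizEndo_apply, smul_smul, two_mul_slitHalf, one_smul]

lemma slitC_ne_zero {p : TM} (hp : p ∈ slit n M) : (slitC : SlitField n M).toField p ≠ 0 := by
  rw [← repField_liouville p hp]
  exact liouville_ne_zero hp

/-- Pointwise: where `c ≠ 0`, multiplying by `c` makes both sides `μ(X) μ(Y) C`; where `c = 0`, `C ≠
0` forces `μ = 0`. -/
lemma slit_smul_swap {c : SlitFun n M} {μ : SlitField n M → SlitFun n M}
    (h : ∀ X, c • slitJ X = μ X • slitC) (X Y : SlitField n M) :
    μ X • slitJ Y = μ Y • slitJ X := SlitField.ext_slit fun p hp => by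
  have h' : ∀ X, c.toFun p • (slitJ X).toField p = (μ X).toFun p • slitC.toField p := fun X => by
    rw [← SlitField.toField_smul _ _ hp, ← SlitField.toField_smul _ _ hp, h]
  rw [SlitField.toField_smul _ _ hp, SlitField.toField_smul _ _ hp]
  by_cases hc : c.toFun p = 0
  · have hμ : ∀ X, (μ X).toFun p = 0 := fun X => by
      have := h' X
      rw [hc, zero_smul] at this
      exact (smul_eq_zero.1 this.symm).resolve_right (slitC_ne_zero hp)
    rw [hμ, hμ, zero_smul, zero_smul]
  · have : c.toFun p • ((μ X).toFun p • (slitJ Y).toField p) =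
        c.toFun p • ((μ Y).toFun p • (slitJ X).toField p) := by
      rw [smul_comm, h', smul_comm (c.toFun p), h', smul_comm]
    exact smul_right_injective _ hc this

lemma dirDeriv_eq_zero_of_eventually {X : VField n M} {f : TM → ℝ} {p : TM}
    (hf : ∀ᶠ q in 𝓝 p, f q = 0) : dirDeriv X f p = 0 := by
  have h : f =ᶠ[𝓝 p] fun _ => (0 : ℝ) := hf
  have h1 := h.mfderiv_eq (I := (𝓡 n).tangent) (I' := 𝓘(ℝ, ℝ))
  rw [mfderiv_const] at h1
  exact congrArg (fun g : EuclideanSpace ℝ (Fin n) × EuclideanSpace ℝ (Fin n) →L[ℝ] ℝ => g (X p)) h1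

/-- From `c² d_hγ = 0` one cannot cancel `c` in a ring with zero divisors. But if `d_hγ(X, Y)` is
nonzero at `p`, it is nonzero nearby, so `c` and then `γ` vanish nearby, and locality gives a
contradiction. -/
lemma slit_dForm_eq_zero {h : SlitField n M →ₗ[SlitFun n M] SlitField n M} {S : SlitField n M}
    (H : IsSprayAlgebra slitJ h slitC S) {γ : SlitField n M →ₗ[SlitFun n M] SlitFun n M}
    (hγ : ∀ V, slitJ V = 0 → γ V = 0) {c : SlitFun n M} (hc : ∀ X, c • slitJ X = γ X • slitC)
    (X Y : SlitField n M) : dForm h γ X Y = 0 := SlitFun.ext_slit fun p hp => by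
  rw [SlitFun.toFun_zero]
  by_contra hne
  have h1 : ∀ᶠ q in 𝓝 p, (dForm h γ X Y).toFun q ≠ 0 :=
    ((dForm h γ X Y).smooth.contMDiffAt hp).continuousAt.eventually_ne hne
  have h2 : ∀ᶠ q in 𝓝 p, q ∈ slit n M ∧ c.toFun q = 0 := by
    filter_upwards [h1, slit_mem_nhds hp] with q hq hqs
    refine ⟨hqs, ?_⟩
    have := congrArg (fun f : SlitFun n M => f.toFun q) (H.sq_mul_dForm_eq_zero hγ hc X Y)
    simp only [pow_two, SlitFun.toFun_mul, SlitFun.toFun_zero] at this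
    simpa [hq] using this
  have h3 : ∀ Z, ∀ᶠ q in 𝓝 p, (γ Z).toFun q = 0 := fun Z => by
    filter_upwards [h2] with q hq
    have := congrArg (fun W : SlitField n M => W.toField q) (hc Z)
    simp only [SlitField.toField_smul _ _ hq.1, hq.2, zero_smul] at this
    exact (smul_eq_zero.1 this.symm).resolve_right (slitC_ne_zero hq.1)
  apply hne
  simp only [dForm, SlitFun.toFun_sub, SlitFun.toFun_lie _ _ hp, (h3 _).self_of_nhds,
    dirDeriv_eq_zero_of_eventually (h3 _), sub_zero]

lemma IsHamel.restrict_eq_zero {S : VField n M} (hS : SmoothField S) {P : TM → ℝ} (hP : IsHamel S P)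
    (X : SlitField n M) :
    ⁅restrictField S hS, ⁅slitJ X, restrictFun P hP.smooth⁆⁆
      - ⁅slitJ ⁅restrictField S hS, X⁆, restrictFun P hP.smooth⁆
      - ⁅X, restrictFun P hP.smooth⁆ = 0 := SlitFun.ext_slit fun p hp => by
  have hs := repField_restrict hS
  have hx := repField_toField X
  have hf := repFun_restrict hP.smooth
  have h := ((hs.dirDeriv (hx.tangentEndo.dirDeriv hf)).sub
    ((hs.lie hx).tangentEndo.dirDeriv hf)).sub (hx.dirDeriv hf)
  rw [SlitFun.toFun_zero, ← h p hp]
  exact hP.eulerLagrange_eq_zero _ X.smooth p hp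

lemma IsHamel.restrict_homogeneous {S : VField n M} {P : TM → ℝ} (hP : IsHamel S P) :
    ⁅(slitC : SlitField n M), restrictFun P hP.smooth⁆ = restrictFun P hP.smooth :=
  SlitFun.ext_slit fun p hp => by
    rw [← repField_liouville.dirDeriv (repFun_restrict hP.smooth) p hp,
      ← repFun_restrict hP.smooth p hp, hP.homogeneous p hp]

lemma slit_isotropic {S : VField n M} (hS : SmoothField S) {α : OneForm n M} (hα : IsSemiBasic α)
    {ρ : TM → ℝ} (hρ : SmoothFun ρ)
    (h : ∀ X : VField n M, SmoothField X → ∀ p ∈ slit n M,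
      jacobiEndo S X p = ρ p • tangentEndo X p - α p (X p) • liouville p) (x : SlitField n M) :
    (⁅restrictField S hS, slitH (restrictField S hS) x⁆
        - slitH (restrictField S hS) ⁅restrictField S hS, x⁆)
      - slitH (restrictField S hS) (⁅restrictField S hS, slitH (restrictField S hS) x⁆
        - slitH (restrictField S hS) ⁅restrictField S hS, x⁆) =
      restrictFun ρ hρ • slitJ x - slitForm α hα.smooth x • slitC :=
  SlitField.ext_slit fun p hp => by
    have hx := repField_toField x
    rw [← (repField_restrict hS).jacobiEndo hx p hp, h _ x.smooth p hp, SlitField.toField_sub,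
      SlitField.toField_smul _ _ hp, SlitField.toField_smul _ _ hp, ← hx.tangentEndo p hp,
      ← repFun_restrict hρ p hp, ← hx.ev hα.smooth p hp, ← repField_liouville p hp]
    rfl

end SlitBundle

end SprayGeometry

end

/-! ### The theorem on `T₀M` -/

open SprayGeometry
theorem lemma3p4 {n : ℕ} {M : Type*} [TopologicalSpace M] [T2Space M] [SecondCountableTopology M]
    [ConnectedSpace M] [ChartedSpace (EuclideanSpace ℝ (Fin n)) M] [IsManifold (𝓡 n) ∞ M]
    (S S' : VField n M) (P : TangentBundle (𝓡 n) M → ℝ) (α α' : OneForm n M)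
    (hS : IsSpray S) (hS' : IsSpray S') (hP : IsHamel S P)
    (hSS' : ∀ p ∈ slit n M, S' p = S p - (2 * P p) • liouville p)
    (hα : IsIsotropicWith S α) (hα' : IsIsotropicWith S' α') :
    ∀ X Y : VField n M, SmoothField X → SmoothField Y → ∀ p ∈ slit n M,
      dAlong (horiz S') α' X Y p =
        dAlong (horiz S) α X Y p - dCurv S P X Y p - P p * dAlong tangentEndo α X Y p
          + wedgeDJ α P X Y p := by
  obtain ⟨hα, ρ, hρ, hΦ⟩ := hα
  obtain ⟨hα', ρ', hρ', hΦ'⟩ := hα'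
  intro X Y hX hY p hp
  have H := hS.isSprayAlgebra
  have H' := hS'.isSprayAlgebra
  have hs := repField_restrict hS.smooth
  have hs' := repField_restrict hS'.smooth
  have hx := repField_restrict hX
  have hy := repField_restrict hY
  have hf := repFun_restrict hP.smooth
  have hE := hP.restrict_eq_zero hS.smooth
  have hC := hP.restrict_homogeneous
  have hI := slit_isotropic hS.smooth hα hρ hΦ
  have hI' := slit_isotropic hS'.smooth hα' hρ' hΦ'
  have hrel : restrictField S' hS'.smooth
      = restrictField S hS.smooth - (2 * restrictFun P hP.smooth) • slitC :=
    SlitField.ext_slit fun q hq => by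
      rw [← hs' q hq, SlitField.toField_sub, SlitField.toField_smul _ _ hq, SlitFun.toFun_mul,
        SlitFun.toFun_two hq, ← hs q hq, ← hf q hq, ← repField_liouville q hq, hSS' q hq]
  have hv := hα.slitForm_vertical
  have hv' := hα'.slitForm_vertical
  have key := H.jacobi_projective hE hC H' hrel
  set s := restrictField S hS.smooth
  set s' := restrictField S' hS'.smooth
  set x := restrictField X hX
  set y := restrictField Y hY
  set f := restrictFun P hP.smooth
  set r := restrictFun ρ hρ
  set r' := restrictFun ρ' hρ'
  set a := slitForm α hα.smooth
  set a' := slitForm α' hα'.smooth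
  -- The defect between `α'` and its expected value `α + β`; it need not vanish when `n = 1`.
  let γ : SlitField n M →ₗ[SlitFun n M] SlitFun n M := a' - (a + (f • dFun slitJ f - dFun (slitH s) f))
  have hγ : ∀ z, γ z = a' z - (a z + (f * ⁅slitJ z, f⁆ - ⁅slitH s z, f⁆)) := fun z => by
    simp [γ]
  have hγv : ∀ V, slitJ V = 0 → γ V = 0 := fun V hV => by
    rw [hγ, hv V hV, hv' V hV, H.horiz_vertical hV, hV]
    simp
  -- Equate the isotropic form of `Φ'` with the one predicted by `jacobi_projective`, and separate
  -- the multiples of `J` and `C`.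
  have hγc : ∀ z, (r' - r - (f ^ 2 - ⁅s, f⁆)) • slitJ z = γ z • slitC := fun z => by
    have h1 := key z
    rw [hI, hI'] at h1
    rw [hγ]
    linear_combination (norm := module) h1
  have two : ∀ b : SlitFun n M, 2 * b = 0 → b = 0 := fun b hb => by
    linear_combination (slitHalf : SlitFun n M) * hb - b * two_mul_slitHalf (n := n) (M := M)
  have main := H.dForm_projective_isotropic hE hC H' two hrel hv
    (α' := a') (γ := γ) (fun z => by rw [hγ]; ring) (slit_dForm_eq_zero H' hγv hγc)
    (slit_smul_swap (H.isotropic_homogeneous hI)) x y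
  have e := congrArg (fun b : SlitFun n M => b.toFun p) main
  simp only [SlitFun.toFun_add, SlitFun.toFun_sub, SlitFun.toFun_mul] at e
  rw [repFun_dAlong (k := slitH s') hs'.horiz hα'.smooth hx hy p hp,
    repFun_dAlong (k := slitH s) hs.horiz hα.smooth hx hy p hp,
    repFun_dAlong (k := slitJ) RepField.tangentEndo hα.smooth hx hy p hp,
    show dCurv S P X Y p = _ from (hs.curvature hx hy).dirDeriv hf p hp, hf p hp,
    show wedgeDJ α P X Y p = _ from (((hx.ev hα.smooth).mul (hy.tangentEndo.dirDeriv hf)).sub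
      ((hy.ev hα.smooth).mul (hx.tangentEndo.dirDeriv hf))) p hp]
  simp only [SlitFun.toFun_sub, SlitFun.toFun_mul]
  exact e
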